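/- **Model.** For integers $n,T\ge 0$ and a finite set $D$, a $D$-way branching program of length (time) $T$ with Boolean output is a leveled rooted DAG whose nodes are partitioned into finite layers $L_0,\dots,L_T$ with $L_0=\{\text{root}\}$. Each node in a layer $L_t$ with $t<T$ is labeled by an input coordinate $i\in\{1,\dots,n\}$ and has $|D|$ outgoing edges, one for each possible value of $x_i\in D$, all leading to nodes of $L_{t+1}$. Each node of $L_T$ is a sink carrying an output bit. On input $x\in D^n$ one starts at the root and follows the edges given by the values of the queried coordinates; the output is the bit of the sink that is reached. The cumulative memory of $P$ is $CM(P)=\sum_{t=0}^{T}\log_2|L_t|$. **Problem.** Let $[N]=\{0,1,\dots,N-1\}$, each element being written in binary with $\lceil\log_2 N\rceil$ bits. The function $HAM_{1/8,n,N}:[N]^n\to\{0,1\}$ is $1$ on $x$ iff there are coordinates $i\ne j$ such that the Hamming distance between the binary representations of $x_i$ and $x_j$ is at most $\frac18\log_2 N$. **Theorem.** There is an absolute constant $C>0$ such that for every function $\tau:\mathbb N\to\mathbb R$ with $\tau(n)=o(n\log n)$ there is a function $\varepsilon:\mathbb N\to\mathbb R$ with $\varepsilon(n)\to 0$ as $n\to\infty$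 for which the following holds for all sufficiently large $n$: for every integer $N\ge n^{4.39}$, every integer $0\le T\le\tau(n)$, and every $[N]$-way branching program $P$ of length $T$ computing $HAM_{1/8,n,N}$, $$CM(P)\;\ge\;\frac{n^2\log_2 n}{2^{\,C\,T/n}}\;\ge\; n^{2-\varepsilon(n)}.$$ -/

import Mathlib

open Filter Topology Asymptotics

/-- A leveled `D`-way branching program of length (time) `T` on inputs `x ∈ D^n`, with Boolean
output.  Its nodes are split into `T + 1` finite layers; layer `0` is `{root}`; a node `v` in a
layer `t < T` is labeled by the input coordinate `query t v` and has one outgoing edge for each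
value `d ∈ D`, leading to the node `next t v d` of layer `t + 1`.  The nodes of the last layer are
the sinks, and each of them carries an output bit. -/
structure BranchingProgram (D : Type) (n T : ℕ) where
  Layer : Fin (T + 1) → Type
  fintypeLayer : ∀ t, Fintype (Layer t)
  root : Layer 0
  eq_root : ∀ v : Layer 0, v = root
  query : ∀ t : Fin T, Layer t.castSucc → Fin n
  next : ∀ t : Fin T, Layer t.castSucc → D → Layer t.succ
  output : Layer (Fin.last T) → Bool

namespace BranchingProgram

attribute [instance] BranchingProgram.fintypeLayer

variable {D : Type} {n T : ℕ}

/-- The node of layer `t` that the computation of `P` on input `x` reaches at time step `t`. -/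
def node (P : BranchingProgram D n T) (x : Fin n → D) (t : Fin (T + 1)) : P.Layer t :=
  Fin.induction (motive := P.Layer) P.root (fun s v => P.next s v (x (P.query s v))) t

/-- The output bit of `P` on input `x`. -/
def eval (P : BranchingProgram D n T) (x : Fin n → D) : Bool :=
  P.output (P.node x (Fin.last T))

/-- `P` computes `f` if it outputs `f x` on every input `x`. -/
def Computes (P : BranchingProgram D n T) (f : (Fin n → D) → Bool) : Prop :=
  ∀ x, P.eval x = f x

/-- Cumulative memory: `∑ t, log₂ |L_t|` over all layers `L_0, …, L_T`. -/
noncomputable def cumulativeMemory (P : BranchingProgram D n T) : ℝ :=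
  ∑ t : Fin (T + 1), Real.logb 2 (Fintype.card (P.Layer t))

end BranchingProgram

/-- The binary representation of `a ∈ {0, …, N - 1}` with `⌈log₂ N⌉` bits. -/
def binaryRep (N : ℕ) (a : Fin N) : Fin (Nat.clog 2 N) → Bool :=
  fun j => (a : ℕ).testBit j

open Classical in
/-- Hamming Closeness `HAM_{γ,n,N}`: is there a pair of distinct input coordinates whose values
have binary representations at Hamming distance at most `γ log₂ N`? -/
noncomputable def hammingCloseness (γ : ℝ) (n N : ℕ) (x : Fin n → Fin N) : Bool :=
  decide (∃ i j : Fin n, i ≠ j ∧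
    (hammingDist (binaryRep N (x i)) (binaryRep N (x j)) : ℝ) ≤ γ * Real.logb 2 N)

/-!
Suppose `P` rejects `x`, and cut time into segments of about `n² / T` steps. Few coordinates are
read in any one segment, so most pairs of coordinates are read in disjoint sets of segments, and a
random set `E` of segments yields `m = n / 2^{O(T/n)}` coordinates `A` read only inside `E` and `m`
coordinates `B` read only outside `E`. Fix `E`, `A`, `B` and the nodes at which the computation
enters new segments. If two rejected inputs share these data and agree outside `A ∪ B`, then the
input taking its `B`-part from the second and the rest from the first is also rejected, because its
computation follows one of the two in every segment. Hence no value of a coordinate in `A` is close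
to a value of a coordinate in `B`, and as two large subsets of the Hamming cube always contain a
close pair, such a class of inputs has density at most `(w / N)^m` with `w = N^{1 - Ω(γ²)}`.

If the segmentation is placed to minimise the memory at its boundaries, there are
`2^{O(T²/n²)} 2^{O(m T / n)} 2^{CM T / n²}` choices of the data, while a constant fraction of all
inputs is rejected since Hamming balls of radius `γ log₂ N` have volume `O(N^{H(γ)})`. Comparing
logarithms gives `CM ≥ n² log n / 2^{O(T/n)}`.

The bound on pairs of subsets is a two-function inequality: if `f x * g y ≤ L ^ d(x, y) * M` on the
cube, then `(∑ f) (∑ g) ≤ (2 + L + L⁻¹) ^ ℓ * M`; it tensorizes, so it is proved by induction on the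
dimension `ℓ`.
-/

section

open Finset

section Cube

theorem add_mul_add_le_of_mul_le {a₀ a₁ b₀ b₁ L M : ℝ} (ha₀ : 0 ≤ a₀) (ha₁ : 0 ≤ a₁)
    (hb₀ : 0 ≤ b₀) (hb₁ : 0 ≤ b₁) (hL : 0 < L) (h₀₀ : a₀ * b₀ ≤ M) (h₁₁ : a₁ * b₁ ≤ M)
    (h₀₁ : a₀ * b₁ ≤ L * M) (h₁₀ : a₁ * b₀ ≤ L * M) :
    (a₀ + a₁) * (b₀ + b₁) ≤ (2 + L + L⁻¹) * M := by
  have hM : 0 ≤ M := (mul_nonneg ha₀ hb₀).trans h₀₀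
  -- `(L M - a₀ b₁) (L M - a₁ b₀) ≥ 0` bounds the sum of the mixed products by their product.
  have hmixed : a₀ * b₁ + a₁ * b₀ ≤ (L + L⁻¹) * M := by
    rcases hM.eq_or_lt with rfl | hM
    · linarith
    have hprod : (a₀ * b₁) * (a₁ * b₀) ≤ M * M := by
      calc (a₀ * b₁) * (a₁ * b₀) = (a₀ * b₀) * (a₁ * b₁) := by ring
        _ ≤ M * M := mul_le_mul h₀₀ h₁₁ (mul_nonneg ha₁ hb₁) hM.le
    refine le_of_mul_le_mul_left ?_ (mul_pos hL hM)
    calc L * M * (a₀ * b₁ + a₁ * b₀) ≤ (L * M) ^ 2 + M * M := by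
          nlinarith [mul_nonneg (sub_nonneg.2 h₀₁) (sub_nonneg.2 h₁₀)]
      _ = L * M * ((L + L⁻¹) * M) := by field_simp
  calc (a₀ + a₁) * (b₀ + b₁) = a₀ * b₀ + a₁ * b₁ + (a₀ * b₁ + a₁ * b₀) := by ring
    _ ≤ M + M + (L + L⁻¹) * M := by linarith
    _ = (2 + L + L⁻¹) * M := by ring

theorem hammingDist_finCons {ℓ : ℕ} {α : Type*} [DecidableEq α] (a b : α) (x y : Fin ℓ → α) :
    hammingDist (Fin.cons a x : Fin (ℓ + 1) → α) (Fin.cons b y) =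
      (if a ≠ b then 1 else 0) + hammingDist x y := by
  simp only [hammingDist, card_filter, Fin.sum_univ_succ, Fin.cons_zero, Fin.cons_succ]

theorem sum_finCons_bool {ℓ : ℕ} {M : Type*} [AddCommMonoid M] (f : (Fin (ℓ + 1) → Bool) → M) :
    ∑ x, f x =
      ∑ x : Fin ℓ → Bool, f (Fin.cons false x) + ∑ x : Fin ℓ → Bool, f (Fin.cons true x) := by
  rw [← (Fin.consEquiv fun _ : Fin (ℓ + 1) => Bool).sum_comp, Fintype.sum_prod_type,
    Fintype.sum_bool, add_comm]
  rfl

theorem sum_mul_sum_le_of_mul_le_pow_hammingDist {L : ℝ} (hL : 0 < L) {ℓ : ℕ}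
    {f g : (Fin ℓ → Bool) → ℝ} {M : ℝ} (hf : ∀ x, 0 ≤ f x) (hg : ∀ y, 0 ≤ g y)
    (h : ∀ x y, f x * g y ≤ L ^ hammingDist x y * M) :
    (∑ x, f x) * ∑ y, g y ≤ (2 + L + L⁻¹) ^ ℓ * M := by
  induction ℓ generalizing M with
  | zero =>
    simpa only [Fintype.sum_subsingleton _ (default : Fin 0 → Bool), hammingDist_self, pow_zero]
      using h default default
  | succ ℓ ih =>
    have hsection (a b : Bool) :
        (∑ x : Fin ℓ → Bool, f (Fin.cons a x)) * ∑ y : Fin ℓ → Bool, g (Fin.cons b y) ≤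
          (2 + L + L⁻¹) ^ ℓ * (L ^ (if a ≠ b then 1 else 0) * M) := by
      refine ih (fun _ => hf _) (fun _ => hg _) fun x y => (h _ _).trans_eq ?_
      rw [hammingDist_finCons, pow_add]
      ring
    rw [sum_finCons_bool, sum_finCons_bool, pow_succ', mul_assoc]
    refine add_mul_add_le_of_mul_le (sum_nonneg fun _ _ => hf _) (sum_nonneg fun _ _ => hf _)
      (sum_nonneg fun _ _ => hg _) (sum_nonneg fun _ _ => hg _) hL
      ((hsection false false).trans_eq ?_) ((hsection true true).trans_eq ?_)
      ((hsection false true).trans_eq ?_) ((hsection true false).trans_eq ?_) <;>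
    simp [mul_left_comm]

theorem card_mul_card_mul_rpow_le {ℓ : ℕ} {L d : ℝ} (hL : 1 ≤ L) {A B : Finset (Fin ℓ → Bool)}
    (h : ∀ x ∈ A, ∀ y ∈ B, d ≤ hammingDist x y) :
    (#A : ℝ) * #B * L ^ d ≤ (2 + L + L⁻¹) ^ ℓ := by
  have hL₀ : 0 < L := one_pos.trans_le hL
  have := sum_mul_sum_le_of_mul_le_pow_hammingDist hL₀ (M := 1)
    (f := fun x => if x ∈ A then 1 else 0) (g := fun y => if y ∈ B then L ^ d else 0)
    (fun x => by positivity) (fun y => by positivity) fun x y => by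
      by_cases hx : x ∈ A
      · by_cases hy : y ∈ B
        · simpa only [hx, hy, if_true, one_mul, mul_one, Real.rpow_natCast]
            using Real.rpow_le_rpow_of_exponent_le hL (h x hx y hy)
        · simp only [hy, if_false, mul_zero]
          positivity
      · simp only [hx, if_false, zero_mul]
        positivity
  simpa only [sum_ite_mem, univ_inter, sum_const, nsmul_eq_mul, mul_one, mul_assoc] using this

theorem two_add_exp_add_inv_le (s : ℝ) :
    2 + Real.exp (2 * s) + (Real.exp (2 * s))⁻¹ ≤ 4 * Real.exp (s ^ 2) := by
  calc 2 + Real.exp (2 * s) + (Real.exp (2 * s))⁻¹ = 4 * Real.cosh s ^ 2 := by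
        rw [show Real.exp (2 * s) = Real.exp s ^ 2 by rw [← Real.exp_nat_mul]; norm_num,
          Real.cosh_eq, Real.exp_neg]
        field_simp
        ring
    _ ≤ 4 * Real.exp (s ^ 2 / 2) ^ 2 := by
        gcongr
        exact Real.cosh_le_exp_half_sq s
    _ = 4 * Real.exp (s ^ 2) := by
        rw [← Real.exp_nat_mul]
        congr 2
        push_cast
        ring

theorem card_mul_card_le_four_pow_mul_exp {ℓ : ℕ} {d : ℝ} (hd : 0 ≤ d)
    {A B : Finset (Fin ℓ → Bool)} (h : ∀ x ∈ A, ∀ y ∈ B, d ≤ hammingDist x y) :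
    (#A : ℝ) * #B ≤ 4 ^ ℓ * Real.exp (-(d ^ 2 / ℓ)) := by
  set s : ℝ := d / ℓ with hs
  have hL : 1 ≤ Real.exp (2 * s) := Real.one_le_exp (by positivity)
  refine le_of_mul_le_mul_right ?_ (Real.exp_pos (2 * s * d))
  calc (#A : ℝ) * #B * Real.exp (2 * s * d) = #A * #B * Real.exp (2 * s) ^ d := by
        rw [Real.exp_mul]
    _ ≤ (2 + Real.exp (2 * s) + (Real.exp (2 * s))⁻¹) ^ ℓ := card_mul_card_mul_rpow_le hL h
    _ ≤ (4 * Real.exp (s ^ 2)) ^ ℓ := by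
        gcongr
        exact two_add_exp_add_inv_le s
    _ = 4 ^ ℓ * Real.exp (-(d ^ 2 / ℓ)) * Real.exp (2 * s * d) := by
        rw [mul_pow, mul_assoc, ← Real.exp_add, ← Real.exp_nat_mul]
        congr 2
        rcases eq_or_ne (ℓ : ℝ) 0 with hℓ | hℓ
        · simp [hs, hℓ]
        · rw [hs]
          field_simp
          ring

variable {ι : Type*} [Fintype ι] [DecidableEq ι]

theorem sum_pow_hammingDist (x : ι → Bool) (ρ : ℝ) :
    ∑ y, ρ ^ hammingDist x y = (1 + ρ) ^ Fintype.card ι := by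
  have hbit (i : ι) : ∑ b : Bool, (if x i ≠ b then ρ else 1) = 1 + ρ := by
    cases x i <;> simp [add_comm]
  calc ∑ y, ρ ^ hammingDist x y = ∑ y : ι → Bool, ∏ i, (if x i ≠ y i then ρ else 1) := by
        simp only [hammingDist, ← prod_const, prod_filter]
    _ = ∏ i, ∑ b : Bool, (if x i ≠ b then ρ else 1) := by
        rw [prod_univ_sum, Fintype.piFinset_univ]
    _ = (1 + ρ) ^ Fintype.card ι := by simp only [hbit, prod_const, card_univ]

theorem card_hammingDist_le_mul_rpow_le (x : ι → Bool) {ρ : ℝ} (hρ₀ : 0 < ρ) (hρ₁ : ρ ≤ 1)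
    (r : ℝ) : (#{y | (hammingDist x y : ℝ) ≤ r} : ℝ) * ρ ^ r ≤ (1 + ρ) ^ Fintype.card ι := by
  rw [← sum_pow_hammingDist x, ← nsmul_eq_mul, ← sum_const]
  calc ∑ _y ∈ {y | (hammingDist x y : ℝ) ≤ r}, ρ ^ r
      ≤ ∑ y ∈ {y | (hammingDist x y : ℝ) ≤ r}, ρ ^ hammingDist x y := by
        refine sum_le_sum fun y hy => ?_
        rw [← Real.rpow_natCast]
        exact Real.rpow_le_rpow_of_exponent_ge hρ₀ hρ₁ (mem_filter.1 hy).2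
    _ ≤ ∑ y, ρ ^ hammingDist x y :=
        sum_le_sum_of_subset_of_nonneg (subset_univ _) fun _ _ _ => by positivity

theorem card_hammingDist_le_exp_binEntropy (x : ι → Bool) {γ t : ℝ} (hγ₀ : 0 < γ)
    (hγ : γ ≤ 1 / 2) (ht : Fintype.card ι ≤ t + 1) :
    (#{y | (hammingDist x y : ℝ) ≤ γ * t} : ℝ) ≤ 2 * Real.exp (t * Real.binEntropy γ) := by
  have hγ' : 0 < 1 - γ := by linarith
  -- the optimal Chernoff parameter
  set ρ : ℝ := γ / (1 - γ) with hρ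
  have hρ₀ : 0 < ρ := by positivity
  have hρ₁ : ρ ≤ 1 := (div_le_one hγ').2 (by linarith)
  have hadd : 1 + ρ = (1 - γ)⁻¹ := by rw [hρ]; field_simp; ring
  have hle₂ : 1 + ρ ≤ 2 := by linarith
  refine le_of_mul_le_mul_right ?_ (Real.rpow_pos_of_pos hρ₀ (γ * t))
  calc (#{y | (hammingDist x y : ℝ) ≤ γ * t} : ℝ) * ρ ^ (γ * t)
      ≤ (1 + ρ) ^ Fintype.card ι := card_hammingDist_le_mul_rpow_le x hρ₀ hρ₁ _
    _ ≤ (1 + ρ) ^ (t + 1) := by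
        rw [← Real.rpow_natCast]
        exact Real.rpow_le_rpow_of_exponent_le (by linarith) ht
    _ ≤ 2 * (1 + ρ) ^ t := by
        rw [Real.rpow_add_one (by positivity), mul_comm]
        gcongr
    _ = 2 * Real.exp (t * Real.binEntropy γ) * ρ ^ (γ * t) := by
        rw [hadd, Real.rpow_def_of_pos (inv_pos.2 hγ'), Real.rpow_def_of_pos hρ₀, mul_assoc,
          ← Real.exp_add, hρ, Real.log_div hγ₀.ne' hγ'.ne', Real.binEntropy]
        simp only [Real.log_inv]
        ring_nf

end Cube

section BinaryRep

theorem binaryRep_injective (N : ℕ) : Function.Injective (binaryRep N) := by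
  intro a b h
  refine Fin.ext (Nat.eq_of_testBit_eq fun j => ?_)
  by_cases hj : j < Nat.clog 2 N
  · exact congrFun h ⟨j, hj⟩
  · have hN : N ≤ 2 ^ j :=
      (Nat.le_pow_clog one_lt_two N).trans (Nat.pow_le_pow_right two_pos (not_lt.1 hj))
    rw [Nat.testBit_lt_two_pow (a.2.trans_le hN), Nat.testBit_lt_two_pow (b.2.trans_le hN)]

theorem clog_two_le_logb_add_one {N : ℕ} (hN : N ≠ 0) : (Nat.clog 2 N : ℝ) ≤ Real.logb 2 N + 1 := by
  have hN₁ : (1 : ℝ) ≤ N := by exact_mod_cast Nat.one_le_iff_ne_zero.2 hN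
  rw [← Real.natCeil_logb_natCast]
  exact (Nat.ceil_lt_add_one (Real.logb_nonneg one_lt_two hN₁)).le

theorem two_pow_clog_two_le {N : ℕ} (hN : N ≠ 0) : (2 : ℝ) ^ Nat.clog 2 N ≤ 2 * N := by
  have hN₀ : (0 : ℝ) < N := by exact_mod_cast Nat.pos_of_ne_zero hN
  calc (2 : ℝ) ^ Nat.clog 2 N = 2 ^ (Nat.clog 2 N : ℝ) := (Real.rpow_natCast _ _).symm
    _ ≤ 2 ^ (Real.logb 2 N + 1) :=
        Real.rpow_le_rpow_of_exponent_le one_le_two (clog_two_le_logb_add_one hN)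
    _ = 2 * N := by
        rw [Real.rpow_add_one two_ne_zero, Real.rpow_logb two_pos (by norm_num) hN₀, mul_comm]

theorem log_le_logb_two {x : ℝ} (hx : 1 ≤ x) : Real.log x ≤ Real.logb 2 x :=
  le_div_self (Real.log_nonneg hx) (Real.log_pos one_lt_two)
    (Real.log_two_lt_d9.le.trans (by norm_num))

/-- The relation that `hammingCloseness γ n N` looks for between two distinct coordinates: the
binary representations of `a` and `b` are at Hamming distance at most `γ log₂ N`. -/
def HammingClose (γ : ℝ) (N : ℕ) (a b : Fin N) : Prop :=
  (hammingDist (binaryRep N a) (binaryRep N b) : ℝ) ≤ γ * Real.logb 2 N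

theorem hammingClose_self {γ : ℝ} (hγ : 0 ≤ γ) {N : ℕ} (a : Fin N) : HammingClose γ N a a := by
  have hN : (1 : ℝ) ≤ N := by exact_mod_cast a.pos
  simpa only [HammingClose, hammingDist_self, Nat.cast_zero]
    using mul_nonneg hγ (Real.logb_nonneg one_lt_two hN)

theorem hammingCloseness_eq_false_iff {γ : ℝ} {n N : ℕ} {x : Fin n → Fin N} :
    hammingCloseness γ n N x = false ↔ Pairwise fun i j => ¬ HammingClose γ N (x i) (x j) := by
  simp [hammingCloseness, HammingClose, Pairwise]

theorem card_mul_card_le_of_not_hammingClose {γ : ℝ} (hγ : 0 ≤ γ) {N : ℕ} (hN : 2 ≤ N)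
    {A B : Finset (Fin N)} (h : ∀ a ∈ A, ∀ b ∈ B, ¬ HammingClose γ N a b) :
    (#A : ℝ) * #B ≤ (2 * (N : ℝ) ^ (1 - γ ^ 2 / 4)) ^ 2 := by
  have hN₀ : (0 : ℝ) < N := by positivity
  have hN₂ : (2 : ℝ) ≤ N := by exact_mod_cast hN
  have hlog : 1 ≤ Real.logb 2 N := by
    rwa [Real.le_logb_iff_rpow_le one_lt_two hN₀, Real.rpow_one]
  have hclog₀ : 0 < (Nat.clog 2 N : ℝ) := by exact_mod_cast Nat.clog_pos one_lt_two hN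
  have hclog : (Nat.clog 2 N : ℝ) ≤ 2 * Real.logb 2 N := by
    linarith [clog_two_le_logb_add_one (N := N) (by lia)]
  have hexp : γ ^ 2 / 2 * Real.log N ≤ (γ * Real.logb 2 N) ^ 2 / Nat.clog 2 N := by
    rw [le_div_iff₀ hclog₀]
    calc γ ^ 2 / 2 * Real.log N * Nat.clog 2 N
        ≤ γ ^ 2 / 2 * Real.logb 2 N * (2 * Real.logb 2 N) := by
          gcongr
          exact log_le_logb_two (by linarith)
      _ = (γ * Real.logb 2 N) ^ 2 := by ring
  have hcube := card_mul_card_le_four_pow_mul_exp (d := γ * Real.logb 2 N)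
    (A := A.image (binaryRep N)) (B := B.image (binaryRep N)) (by positivity) (by
      simp only [forall_mem_image]
      exact fun a ha b hb => (not_le.1 (h a ha b hb)).le)
  rw [card_image_of_injective _ (binaryRep_injective N),
    card_image_of_injective _ (binaryRep_injective N)] at hcube
  calc (#A : ℝ) * #B
      ≤ (2 ^ Nat.clog 2 N) ^ 2 * Real.exp (-((γ * Real.logb 2 N) ^ 2 / Nat.clog 2 N)) := by
        rwa [pow_right_comm, show (2 : ℝ) ^ 2 = 4 by norm_num]
    _ ≤ (2 * N) ^ 2 * Real.exp (-(γ ^ 2 / 2 * Real.log N)) := by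
        gcongr
        exact two_pow_clog_two_le (by lia)
    _ = (2 * (N : ℝ) ^ (1 - γ ^ 2 / 4)) ^ 2 := by
        rw [Real.rpow_sub hN₀, Real.rpow_one, Real.rpow_def_of_pos hN₀, Real.exp_neg, mul_pow,
          mul_pow, div_pow, ← Real.exp_nat_mul, div_eq_mul_inv, mul_assoc]
        push_cast
        ring_nf

open Classical in
theorem card_hammingClose_le {γ : ℝ} (hγ₀ : 0 < γ) (hγ : γ ≤ 1 / 2) {N : ℕ} (a : Fin N) :
    (#{b | HammingClose γ N a b} : ℝ) ≤ 2 * (N : ℝ) ^ (Real.binEntropy γ / Real.log 2) := by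
  have hN₀ : (0 : ℝ) < N := by exact_mod_cast a.pos
  have himage : #{b | HammingClose γ N a b} ≤
      #{y | (hammingDist (binaryRep N a) y : ℝ) ≤ γ * Real.logb 2 N} :=
    card_le_card_of_injOn (binaryRep N)
      (fun b hb => mem_coe.2 (mem_filter.2 ⟨mem_univ _, (mem_filter.1 (mem_coe.1 hb)).2⟩))
      (binaryRep_injective N).injOn
  calc (#{b | HammingClose γ N a b} : ℝ)
      ≤ #{y | (hammingDist (binaryRep N a) y : ℝ) ≤ γ * Real.logb 2 N} := by
        exact_mod_cast himage
    _ ≤ 2 * Real.exp (Real.logb 2 N * Real.binEntropy γ) :=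
        card_hammingDist_le_exp_binEntropy _ hγ₀ hγ
          (by simpa using clog_two_le_logb_add_one a.pos.ne')
    _ = 2 * (N : ℝ) ^ (Real.binEntropy γ / Real.log 2) := by
        rw [Real.rpow_def_of_pos hN₀, Real.logb, div_mul_eq_mul_div, mul_div_assoc]

end BinaryRep

section PairwiseUnrelated

variable {ι D : Type*} [Fintype ι] [DecidableEq ι] [Fintype D] {r : D → D → Prop} {V : ℕ}

open Classical in
theorem card_filter_rel_apply_mul_card_le (hV : ∀ a, #{b | r a b} ≤ V) {i j : ι} (hij : i ≠ j) :
    #{x : ι → D | r (x i) (x j)} * Fintype.card D ≤ V * Fintype.card D ^ Fintype.card ι := by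
  have hfiber (u : {k // k ≠ j} → D) :
      #{x ∈ ({x : ι → D | r (x i) (x j)} : Finset _) | (fun k : {k // k ≠ j} => x k) = u} ≤ V := by
    refine (card_le_card_of_injOn (fun x => x j) (fun x hx => ?_) fun x hx y hy hxy => ?_).trans
      (hV (u ⟨i, hij⟩))
    · simp only [coe_filter, mem_filter, mem_univ, true_and, Set.mem_ofPred_eq] at hx ⊢
      exact hx.2 ▸ hx.1
    · simp only [coe_filter, mem_filter, mem_univ, true_and, Set.mem_ofPred_eq] at hx hy
      funext k
      by_cases hk : k = j
      · exact hk ▸ hxy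
      · exact congrFun (hx.2.trans hy.2.symm) ⟨k, hk⟩
  have hpow : Fintype.card ({k // k ≠ j} → D) * Fintype.card D =
      Fintype.card D ^ Fintype.card ι := by
    rw [Fintype.card_fun, Fintype.card_subtype_compl, Fintype.card_subtype_eq, ← pow_succ,
      Nat.sub_add_cancel (Fintype.card_pos_iff.2 ⟨j⟩)]
  calc #{x : ι → D | r (x i) (x j)} * Fintype.card D
      ≤ V * Fintype.card ({k // k ≠ j} → D) * Fintype.card D :=
        Nat.mul_le_mul_right _ (card_le_mul_card_image_of_maps_to (fun _ _ => mem_univ _) V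
          fun u _ => hfiber u)
    _ = V * Fintype.card D ^ Fintype.card ι := by rw [mul_assoc, hpow]

open Classical in
theorem card_pow_le_two_mul_card_pairwise_not_rel [Nonempty D] (hV : ∀ a, #{b | r a b} ≤ V)
    (hcard : 2 * Fintype.card ι ^ 2 * V ≤ Fintype.card D) :
    Fintype.card D ^ Fintype.card ι ≤
      2 * #{x : ι → D | Pairwise fun i j => ¬ r (x i) (x j)} := by
  set good : Finset (ι → D) := {x | Pairwise fun i j => ¬ r (x i) (x j)}
  have hcover : goodᶜ ⊆ univ.offDiag.biUnion fun p => {x : ι → D | r (x p.1) (x p.2)} := by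
    intro x hx
    have hnot : ¬ Pairwise fun i j => ¬ r (x i) (x j) := fun h =>
      mem_compl.1 hx (mem_filter.2 ⟨mem_univ _, h⟩)
    simp only [Pairwise, not_forall, not_not] at hnot
    obtain ⟨i, j, hij, hr⟩ := hnot
    exact mem_biUnion.2 ⟨(i, j), by simpa using hij, by simpa using hr⟩
  have hbad : #goodᶜ * Fintype.card D ≤
      Fintype.card ι ^ 2 * (V * Fintype.card D ^ Fintype.card ι) :=
    calc #goodᶜ * Fintype.card D
        ≤ ∑ p ∈ univ.offDiag, #{x : ι → D | r (x p.1) (x p.2)} * Fintype.card D := by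
          rw [← sum_mul]
          exact Nat.mul_le_mul_right _ ((card_le_card hcover).trans card_biUnion_le)
      _ ≤ #(univ : Finset ι).offDiag * (V * Fintype.card D ^ Fintype.card ι) :=
          sum_le_card_nsmul _ _ _ fun p hp =>
            card_filter_rel_apply_mul_card_le hV (mem_offDiag.1 hp).2.2
      _ ≤ Fintype.card ι ^ 2 * (V * Fintype.card D ^ Fintype.card ι) := by
          refine Nat.mul_le_mul_right _ ?_
          rw [offDiag_card, card_univ, sq]
          exact Nat.sub_le _ _
  have hhalf : 2 * #goodᶜ ≤ Fintype.card D ^ Fintype.card ι := by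
    refine Nat.le_of_mul_le_mul_right ?_ (Fintype.card_pos (α := D))
    calc 2 * #goodᶜ * Fintype.card D
        ≤ 2 * Fintype.card ι ^ 2 * V * Fintype.card D ^ Fintype.card ι := by linarith
      _ ≤ Fintype.card D ^ Fintype.card ι * Fintype.card D := by
          rw [mul_comm]
          exact Nat.mul_le_mul_left _ hcard
  have hadd := card_add_card_compl good
  rw [Fintype.card_fun] at hadd
  lia

end PairwiseUnrelated

section Splitting

variable {ι σ : Type*} [Fintype ι]

theorem card_le_two_mul_card_filter_le {w : ι → ℕ} {K : ℕ} (hK : 1 ≤ K)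
    (hw : ∑ i, w i ≤ K * Fintype.card ι) : Fintype.card ι ≤ 2 * #{i | w i ≤ 2 * K} := by
  have hmarkov : #{i | ¬ w i ≤ 2 * K} * (2 * K) ≤ K * Fintype.card ι :=
    calc #{i | ¬ w i ≤ 2 * K} * (2 * K) ≤ ∑ i with ¬ w i ≤ 2 * K, w i :=
          card_nsmul_le_sum _ w _ fun i hi => (not_le.1 (mem_filter.1 hi).2).le
      _ ≤ K * Fintype.card ι := (sum_le_sum_of_subset (subset_univ _)).trans hw
  have hhalf : 2 * #{i | ¬ w i ≤ 2 * K} ≤ Fintype.card ι :=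
    Nat.le_of_mul_le_mul_left (by linarith) hK
  have hadd := card_filter_add_card_filter_not (s := univ) fun i => w i ≤ 2 * K
  rw [card_univ] at hadd
  lia

variable [DecidableEq σ]

theorem sum_card_filter_subset_disjoint [Fintype σ] (S : ι → Finset σ) :
    ∑ p : ι × ι, #{E : Finset σ | S p.1 ⊆ E ∧ Disjoint (S p.2) E} =
      ∑ E : Finset σ, #{i | S i ⊆ E} * #{j | Disjoint (S j) E} := by
  simp only [card_filter]
  rw [sum_comm]
  refine sum_congr rfl fun E _ => ?_
  rw [sum_mul_sum, ← sum_product']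
  exact sum_congr rfl fun p _ => by simp [← ite_and, and_comm]

variable {S : ι → Finset σ}

theorem card_filter_not_disjoint_le {T h : ℕ} (hT : ∑ i, #(S i) ≤ T)
    (hS : ∀ s, #{i | s ∈ S i} ≤ h) : #{p : ι × ι | ¬ Disjoint (S p.1) (S p.2)} ≤ T * h := by
  classical
  have hcover : ({p | ¬ Disjoint (S p.1) (S p.2)} : Finset (ι × ι)) ⊆
      (univ.sigma S).biUnion fun q => ({j | q.2 ∈ S j} : Finset ι).image (Prod.mk q.1) := by
    rintro ⟨i, j⟩ hp
    obtain ⟨s, hi, hj⟩ := not_disjoint_iff.1 (mem_filter.1 hp).2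
    exact mem_biUnion.2 ⟨⟨i, s⟩, by simpa using hi, by simpa using hj⟩
  calc #{p : ι × ι | ¬ Disjoint (S p.1) (S p.2)} ≤ #(univ.sigma S) * h :=
        (card_le_card hcover).trans
          (card_biUnion_le_card_mul _ _ h fun q _ => card_image_le.trans (hS _))
    _ ≤ T * h := by
        rw [card_sigma]
        exact Nat.mul_le_mul_right _ hT

theorem sq_card_le_eight_mul_card_disjoint_pairs {T K h : ℕ} (hK : 1 ≤ K)
    (hT : ∑ i, #(S i) ≤ T) (hTK : T ≤ K * Fintype.card ι) (hS : ∀ s, #{i | s ∈ S i} ≤ h)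
    (hTh : 8 * (T * h) ≤ Fintype.card ι ^ 2) :
    Fintype.card ι ^ 2 ≤
      8 * #{p : ι × ι | (#(S p.1) ≤ 2 * K ∧ #(S p.2) ≤ 2 * K) ∧ Disjoint (S p.1) (S p.2)} := by
  have hsmall := card_le_two_mul_card_filter_le hK (hT.trans hTK)
  set I : Finset ι := {i | #(S i) ≤ 2 * K} with hI
  have hfilter : ({p | (#(S p.1) ≤ 2 * K ∧ #(S p.2) ≤ 2 * K) ∧ Disjoint (S p.1) (S p.2)} :
      Finset (ι × ι)) = {p ∈ I ×ˢ I | Disjoint (S p.1) (S p.2)} := by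
    ext p
    simp [hI]
  have hadd := card_filter_add_card_filter_not (s := I ×ˢ I) fun p => Disjoint (S p.1) (S p.2)
  have hnot : #{p ∈ I ×ˢ I | ¬ Disjoint (S p.1) (S p.2)} ≤ T * h :=
    (card_le_card (filter_subset_filter _ (subset_univ _))).trans
      (card_filter_not_disjoint_le hT hS)
  rw [card_product] at hadd
  rw [hfilter]
  nlinarith [Nat.mul_le_mul hsmall hsmall]

theorem two_pow_card_le_card_filter_subset_disjoint_mul [Fintype σ] {s t : Finset σ} {K : ℕ}
    (hst : Disjoint s t) (hs : #s ≤ 2 * K) (ht : #t ≤ 2 * K) :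
    2 ^ Fintype.card σ ≤ #{E : Finset σ | s ⊆ E ∧ Disjoint t E} * 16 ^ K := by
  have hIcc : ({E | s ⊆ E ∧ Disjoint t E} : Finset (Finset σ)) = Icc s tᶜ := by
    ext E
    simp only [mem_filter, mem_univ, true_and, mem_Icc, disjoint_comm (a := t),
      subset_compl_iff_disjoint_right]
  rw [hIcc, card_Icc_finset (subset_compl_iff_disjoint_right.2 hst), card_compl,
    show (16 : ℕ) = 2 ^ 4 from rfl, ← pow_mul, ← pow_add]
  exact Nat.pow_le_pow_right two_pos (by lia)

theorem exists_sq_card_le_card_mul_card [Finite σ] {T K h : ℕ} (hK : 1 ≤ K) (hT : ∑ i, #(S i) ≤ T)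
    (hTK : T ≤ K * Fintype.card ι) (hS : ∀ s, #{i | s ∈ S i} ≤ h)
    (hTh : 8 * (T * h) ≤ Fintype.card ι ^ 2) :
    ∃ E : Finset σ,
      Fintype.card ι ^ 2 ≤ 8 * 16 ^ K * (#{i | S i ⊆ E} * #{j | Disjoint (S j) E}) := by
  cases nonempty_fintype σ
  set pairs : Finset (ι × ι) :=
    {p | (#(S p.1) ≤ 2 * K ∧ #(S p.2) ≤ 2 * K) ∧ Disjoint (S p.1) (S p.2)}
  suffices hsum : ∑ _E : Finset σ, Fintype.card ι ^ 2 ≤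
      ∑ E : Finset σ, 8 * 16 ^ K * (#{i | S i ⊆ E} * #{j | Disjoint (S j) E}) by
    obtain ⟨E, -, hE⟩ := exists_le_of_sum_le univ_nonempty hsum
    exact ⟨E, hE⟩
  calc ∑ _E : Finset σ, Fintype.card ι ^ 2 = 2 ^ Fintype.card σ * Fintype.card ι ^ 2 := by
        rw [sum_const, card_univ, Fintype.card_finset, smul_eq_mul]
    _ ≤ 2 ^ Fintype.card σ * (8 * #pairs) :=
        Nat.mul_le_mul_left _ (sq_card_le_eight_mul_card_disjoint_pairs hK hT hTK hS hTh)
    _ = 8 * ∑ _p ∈ pairs, 2 ^ Fintype.card σ := by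
        rw [sum_const, smul_eq_mul]
        ring
    _ ≤ 8 * ∑ p ∈ pairs, #{E : Finset σ | S p.1 ⊆ E ∧ Disjoint (S p.2) E} * 16 ^ K := by
        refine Nat.mul_le_mul_left _ (sum_le_sum fun p hp => ?_)
        obtain ⟨⟨hp₁, hp₂⟩, hdisj⟩ := (mem_filter.1 hp).2
        exact two_pow_card_le_card_filter_subset_disjoint_mul hdisj hp₁ hp₂
    _ ≤ 8 * ∑ p : ι × ι, #{E : Finset σ | S p.1 ⊆ E ∧ Disjoint (S p.2) E} * 16 ^ K :=
        Nat.mul_le_mul_left _ (sum_le_sum_of_subset (subset_univ _))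
    _ = ∑ E : Finset σ, 8 * 16 ^ K * (#{i | S i ⊆ E} * #{j | Disjoint (S j) E}) := by
        rw [← sum_mul, sum_card_filter_subset_disjoint, ← mul_sum]
        ring

-- A set `E` chosen uniformly at random contains `S i` and avoids `S j` with probability at least
-- `16⁻ᴷ` for each of the `≥ n² / 8` disjoint pairs of small sets, and some `E` attains the mean.
theorem exists_card_eq_subset_disjoint [Finite σ] [Nonempty ι] {T K h m : ℕ} (hK : 1 ≤ K)
    (hT : ∑ i, #(S i) ≤ T) (hTK : T ≤ K * Fintype.card ι) (hS : ∀ s, #{i | s ∈ S i} ≤ h)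
    (hTh : 8 * (T * h) ≤ Fintype.card ι ^ 2) (hm : 16 * m * 16 ^ K ≤ Fintype.card ι) :
    ∃ (E : Finset σ) (A B : Finset ι), #A = m ∧ #B = m ∧ Disjoint A B ∧
      (∀ i ∈ A, S i ⊆ E) ∧ ∀ i ∈ B, Disjoint (S i) E := by
  classical
  obtain ⟨E, hE⟩ := exists_sq_card_le_card_mul_card hK hT hTK hS hTh
  have hlarge {a b : ℕ} (hab : Fintype.card ι ^ 2 ≤ 8 * 16 ^ K * (a * b))
      (ha : a ≤ Fintype.card ι) : 2 * m ≤ b := by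
    refine le_of_mul_le_mul_left (a := 8 * 16 ^ K * Fintype.card ι) ?_
      (by have := Fintype.card_pos (α := ι); positivity)
    calc 8 * 16 ^ K * Fintype.card ι * (2 * m) = Fintype.card ι * (16 * m * 16 ^ K) := by ring
      _ ≤ Fintype.card ι * Fintype.card ι := Nat.mul_le_mul_left _ hm
      _ = Fintype.card ι ^ 2 := (sq _).symm
      _ ≤ 8 * 16 ^ K * (a * b) := hab
      _ ≤ 8 * 16 ^ K * (Fintype.card ι * b) := by gcongr
      _ = 8 * 16 ^ K * Fintype.card ι * b := by ring
  have hdisj : 2 * m ≤ #{i | Disjoint (S i) E} := hlarge hE (card_le_univ _)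
  have hsub : 2 * m ≤ #{i | S i ⊆ E} := hlarge (by rwa [mul_comm #_] at hE) (card_le_univ _)
  obtain ⟨A, hA, hAm⟩ := exists_subset_card_eq (show m ≤ #{i | S i ⊆ E} by lia)
  have hsdiff : m ≤ #(({i | Disjoint (S i) E} : Finset ι) \ A) := by
    have := le_card_sdiff A ({i | Disjoint (S i) E} : Finset ι)
    lia
  obtain ⟨B, hB, hBm⟩ := exists_subset_card_eq hsdiff
  refine ⟨E, A, B, hAm, hBm, disjoint_of_subset_right hB disjoint_sdiff, fun i hi => ?_,
    fun i hi => ?_⟩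
  · exact (mem_filter_univ i).1 (hA hi)
  · exact (mem_filter_univ i).1 (mem_sdiff.1 (hB hi)).1

end Splitting

/-- No two sets of more than `w` elements each are entirely unrelated by `r`: the quantitative
property of the closeness relation on which the lower bound rests. -/
def NoLargeUnrelatedPair {D : Type*} (r : D → D → Prop) (w : ℝ) : Prop :=
  ∀ A B : Finset D, (∀ a ∈ A, ∀ b ∈ B, ¬ r a b) → (#A : ℝ) ≤ w ∨ (#B : ℝ) ≤ w

theorem NoLargeUnrelatedPair.nonneg {D : Type*} {r : D → D → Prop} {w : ℝ}
    (hw : NoLargeUnrelatedPair r w) : 0 ≤ w := by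
  simpa using hw ∅ ∅ (by simp)

section Rectangle

variable {ι D : Type*} [DecidableEq ι] {A B : Finset ι} {K : Finset (ι → D)}

theorem card_le_pow_mul_pow_of_card_image_le [Finite ι] [DecidableEq D] (hAB : Disjoint A B)
    (hagree : ∀ x ∈ K, ∀ y ∈ K, ∀ i ∉ A ∪ B, x i = y i) {α β : ℝ}
    (hα : ∀ i ∈ A, (#(K.image fun x => x i) : ℝ) ≤ α)
    (hβ : ∀ i ∈ B, (#(K.image fun x => x i) : ℝ) ≤ β) : (#K : ℝ) ≤ α ^ #A * β ^ #B := by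
  cases nonempty_fintype ι
  set c : ι → ℝ := fun i => #(K.image fun x => x i) with hc
  have hc₀ (i : ι) : 0 ≤ c i := Nat.cast_nonneg _
  have houtside (i : ι) (hi : i ∈ (A ∪ B)ᶜ) : c i ≤ 1 := by
    refine Nat.cast_le_one.2 (card_le_one.2 fun a ha b hb => ?_)
    obtain ⟨x, hx, rfl⟩ := mem_image.1 ha
    obtain ⟨y, hy, rfl⟩ := mem_image.1 hb
    exact hagree x hx y hy i (mem_compl.1 hi)
  have hbox : K ⊆ Fintype.piFinset fun i => K.image fun x => x i := fun x hx =>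
    Fintype.mem_piFinset.2 fun i => mem_image_of_mem (fun x => x i) hx
  calc (#K : ℝ) ≤ ∏ i, c i := by
        have := card_le_card hbox
        rw [Fintype.card_piFinset] at this
        simp only [hc]
        exact_mod_cast this
    _ = ((∏ i ∈ A, c i) * ∏ i ∈ B, c i) * ∏ i ∈ (A ∪ B)ᶜ, c i := by
        rw [← prod_union hAB, prod_mul_prod_compl]
    _ ≤ (∏ i ∈ A, c i) * ∏ i ∈ B, c i :=
        mul_le_of_le_one_right (mul_nonneg (prod_nonneg fun i _ => hc₀ i)
          (prod_nonneg fun i _ => hc₀ i)) (prod_le_one (fun i _ => hc₀ i) houtside)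
    _ ≤ α ^ #A * β ^ #B := by
        rw [← prod_const, ← prod_const]
        exact mul_le_mul (prod_le_prod (fun i _ => hc₀ i) hα)
          (prod_le_prod (fun i _ => hc₀ i) hβ) (prod_nonneg fun i _ => hc₀ i)
          (prod_nonneg fun i hi => (hc₀ i).trans (hα i hi))

variable [Fintype D] {r : D → D → Prop} {w : ℝ} {m : ℕ}

theorem NoLargeUnrelatedPair.card_le_of_agree [Finite ι] (hw : NoLargeUnrelatedPair r w)
    (hAB : Disjoint A B) (hA : #A = m) (hB : #B = m)
    (hagree : ∀ x ∈ K, ∀ y ∈ K, ∀ i ∉ A ∪ B, x i = y i)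
    (hunrel : ∀ x ∈ K, ∀ y ∈ K, ∀ i ∈ A, ∀ j ∈ B, ¬ r (x i) (y j)) :
    (#K : ℝ) ≤ w ^ m * Fintype.card D ^ m := by
  classical
  have huniv (i : ι) : (#(K.image fun x => x i) : ℝ) ≤ Fintype.card D :=
    Nat.cast_le.2 (card_le_univ _)
  have hside (i : ι) (hi : i ∈ A) (j : ι) (hj : j ∈ B) :
      (#(K.image fun x => x i) : ℝ) ≤ w ∨ (#(K.image fun x => x j) : ℝ) ≤ w := by
    refine hw _ _ ?_
    simp only [forall_mem_image]
    exact fun x hx y hy => hunrel x hx y hy i hi j hj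
  by_cases hall : ∀ i ∈ A, (#(K.image fun x => x i) : ℝ) ≤ w
  · simpa only [hA, hB] using
      card_le_pow_mul_pow_of_card_image_le hAB hagree hall fun i _ => huniv i
  · push Not at hall
    obtain ⟨i, hi, hiw⟩ := hall
    rw [mul_comm]
    simpa only [hA, hB] using card_le_pow_mul_pow_of_card_image_le hAB hagree
      (fun i _ => huniv i) fun j hj => (hside i hi j hj).resolve_left hiw.not_ge

theorem NoLargeUnrelatedPair.card_le [Fintype ι] (hw : NoLargeUnrelatedPair r w)
    (hAB : Disjoint A B) (hA : #A = m) (hB : #B = m)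
    (hunrel : ∀ x ∈ K, ∀ y ∈ K, (∀ i ∉ A ∪ B, x i = y i) →
      ∀ i ∈ A, ∀ j ∈ B, ¬ r (x i) (y j)) :
    (#K : ℝ) ≤ w ^ m * Fintype.card D ^ (Fintype.card ι - m) := by
  classical
  have hfiber (u : {i // i ∈ (A ∪ B)ᶜ} → D) :
      (#{x ∈ K | (fun i : {i // i ∈ (A ∪ B)ᶜ} => x i) = u} : ℝ) ≤
        w ^ m * Fintype.card D ^ m := by
    have hagree : ∀ x ∈ ({x ∈ K | (fun i : {i // i ∈ (A ∪ B)ᶜ} => x i) = u} : Finset (ι → D)),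
        ∀ y ∈ ({x ∈ K | (fun i : {i // i ∈ (A ∪ B)ᶜ} => x i) = u} : Finset (ι → D)),
        ∀ i ∉ A ∪ B, x i = y i := fun x hx y hy i hi =>
      congrFun ((mem_filter.1 hx).2.trans (mem_filter.1 hy).2.symm) ⟨i, mem_compl.2 hi⟩
    exact hw.card_le_of_agree hAB hA hB hagree fun x hx y hy =>
      hunrel x (mem_filter.1 hx).1 y (mem_filter.1 hy).1 (hagree x hx y hy)
  have hm : m + m ≤ Fintype.card ι := by
    have := card_le_univ (A ∪ B)
    rwa [card_union_of_disjoint hAB, hA, hB] at this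
  have hpow : Fintype.card ({i // i ∈ (A ∪ B)ᶜ} → D) =
      Fintype.card D ^ (Fintype.card ι - (m + m)) := by
    rw [Fintype.card_fun, Fintype.card_coe, card_compl, card_union_of_disjoint hAB, hA, hB]
  calc (#K : ℝ) = ∑ u, (#{x ∈ K | (fun i : {i // i ∈ (A ∪ B)ᶜ} => x i) = u} : ℝ) := by
        exact_mod_cast card_eq_sum_card_fiberwise fun _ _ => mem_coe.2 (mem_univ _)
    _ ≤ Fintype.card ({i // i ∈ (A ∪ B)ᶜ} → D) • (w ^ m * Fintype.card D ^ m) :=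
        sum_le_card_nsmul _ _ _ fun u _ => hfiber u
    _ = w ^ m * Fintype.card D ^ (Fintype.card ι - m) := by
        rw [nsmul_eq_mul, hpow, show Fintype.card ι - m = Fintype.card ι - (m + m) + m by lia,
          pow_add]
        push_cast
        ring

end Rectangle

section Segmentation

theorem card_range_filter_dvd_add_le_one (h t : ℕ) : #{c ∈ range h | h ∣ t + c} ≤ 1 := by
  refine card_le_one.2 fun a ha b hb => ?_
  rw [mem_filter, mem_range] at ha hb
  have hmod : t + a ≡ t + b [MOD h] :=
    (Nat.modEq_zero_iff_dvd.2 ha.2).trans (Nat.modEq_zero_iff_dvd.2 hb.2).symm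
  exact (Nat.ModEq.add_left_cancel' t hmod).eq_of_lt_of_lt ha.1 hb.1

theorem exists_offset_mul_sum_le {T h : ℕ} (hh : 1 ≤ h) {f : Fin T → ℝ} (hf : ∀ t, 0 ≤ f t) :
    ∃ c < h, h * ∑ t ∈ {t : Fin T | h ∣ (t : ℕ) + c}, f t ≤ ∑ t, f t := by
  suffices hsum : ∑ c ∈ range h, h * ∑ t ∈ {t : Fin T | h ∣ (t : ℕ) + c}, f t ≤
      ∑ _c ∈ range h, ∑ t, f t by
    obtain ⟨c, hc, hle⟩ := exists_le_of_sum_le (nonempty_range_iff.2 (by lia)) hsum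
    exact ⟨c, mem_range.1 hc, hle⟩
  rw [← mul_sum, sum_const, card_range, nsmul_eq_mul]
  gcongr
  simp only [sum_filter]
  rw [sum_comm]
  refine sum_le_sum fun t _ => ?_
  rw [← sum_filter, sum_const, nsmul_eq_mul]
  exact mul_le_of_le_one_left (hf t) (Nat.cast_le_one.2 (card_range_filter_dvd_add_le_one h t))

theorem card_filter_add_div_eq_le {T h c s : ℕ} (hh : 1 ≤ h) :
    #{t : Fin T | ((t : ℕ) + c) / h = s} ≤ h := by
  calc #{t : Fin T | ((t : ℕ) + c) / h = s} ≤ #(Ico (s * h) (s * h + h)) := by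
        refine card_le_card_of_injOn (fun t => (t : ℕ) + c) (fun t ht => ?_)
          fun a _ b _ hab => Fin.ext (Nat.add_right_cancel hab)
        have hdiv : ((t : ℕ) + c) / h = s := by simpa using ht
        rw [Nat.div_eq_iff (by lia)] at hdiv
        exact mem_coe.2 (mem_Ico.2 (by lia))
    _ = h := by rw [Nat.card_Ico, Nat.add_sub_cancel_left]

/-- The times at which a division of the times `0, …, T` into segments enters a new segment. -/
def segmentBoundary {T : ℕ} {σ : Type*} [DecidableEq σ] (seg : Fin (T + 1) → σ) :
    Finset (Fin (T + 1)) :=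
  {t | ∃ s : Fin T, t = s.succ ∧ seg s.succ ≠ seg s.castSucc}

theorem succ_mem_segmentBoundary {T : ℕ} {σ : Type*} [DecidableEq σ] {seg : Fin (T + 1) → σ}
    {t : Fin T} : t.succ ∈ segmentBoundary seg ↔ seg t.succ ≠ seg t.castSucc := by
  simp [segmentBoundary]

theorem exists_segmentation {T h : ℕ} (hh : 1 ≤ h) {f : Fin (T + 1) → ℝ} (hf : ∀ t, 0 ≤ f t) :
    ∃ seg : Fin (T + 1) → Fin (T / h + 2), (∀ s, #{t : Fin T | seg t.castSucc = s} ≤ h) ∧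
      h * ∑ t ∈ segmentBoundary seg, f t ≤ ∑ t, f t := by
  obtain ⟨c, hc, hsum⟩ := exists_offset_mul_sum_le hh hf
  have hlt (t : Fin (T + 1)) : ((t : ℕ) + c) / h < T / h + 2 := by
    have hdiv : ((t : ℕ) + c) / h ≤ (T + h) / h := Nat.div_le_div_right (by lia)
    rw [Nat.add_div_right _ hh] at hdiv
    lia
  let seg (t : Fin (T + 1)) : Fin (T / h + 2) := ⟨((t : ℕ) + c) / h, hlt t⟩
  have hboundary : segmentBoundary seg ⊆ ({t | h ∣ (t : ℕ) + c} : Finset (Fin (T + 1))) := by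
    intro t ht
    obtain ⟨s, rfl, hs⟩ := (mem_filter.1 ht).2
    refine mem_filter.2 ⟨mem_univ _, by_contra fun hdvd => hs (Fin.ext ?_)⟩
    simp only [Fin.val_succ, add_right_comm _ 1 c] at hdvd
    simp only [seg, Fin.val_succ, Fin.val_castSucc, add_right_comm _ 1 c, Nat.succ_div,
      if_neg hdvd, add_zero]
  refine ⟨seg, fun s => ?_, ?_⟩
  · simpa only [seg, Fin.ext_iff, Fin.val_castSucc] using
      card_filter_add_div_eq_le (T := T) (c := c) (s := s) hh
  · refine le_trans ?_ hsum
    gcongr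
    exact fun t _ _ => hf t

end Segmentation

theorem exists_mul_le_and_le_two_mul {a b : ℕ} (ha : 0 < a) (hab : a ≤ b) :
    ∃ q, 1 ≤ q ∧ a * q ≤ b ∧ b ≤ 2 * (a * q) := by
  have hq : 1 ≤ b / a := Nat.div_pos hab ha
  have := Nat.div_add_mod b a
  have := Nat.mod_lt b ha
  exact ⟨b / a, hq, Nat.mul_div_le b a, by nlinarith⟩

theorem choose_le_two_pow_mul {n m b : ℕ} (hb : n ≤ 2 ^ b * m) :
    n.choose m ≤ 2 ^ ((b + 2) * m) := by
  have hexp : Real.exp m ≤ 4 ^ m := by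
    rw [← Real.exp_one_pow]
    exact pow_le_pow_left₀ (Real.exp_pos _).le (by linarith [Real.exp_one_lt_d9]) m
  have hb' : (n : ℝ) ≤ 2 ^ b * m := by exact_mod_cast hb
  have hreal : (n.choose m : ℝ) ≤ 2 ^ ((b + 2) * m) := by
    calc (n.choose m : ℝ) ≤ (n : ℝ) ^ m / m.factorial := Nat.choose_le_pow_div m n
      _ ≤ (2 ^ b * m : ℝ) ^ m / m.factorial := by gcongr
      _ = (2 ^ b) ^ m * ((m : ℝ) ^ m / m.factorial) := by rw [mul_pow, mul_div_assoc]
      _ ≤ (2 ^ b) ^ m * 4 ^ m := by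
          gcongr
          exact (Real.pow_div_factorial_le_exp m m.cast_nonneg m).trans hexp
      _ = 2 ^ ((b + 2) * m) := by rw [← mul_pow, pow_mul, pow_add]; norm_num
  exact_mod_cast hreal

namespace BranchingProgram

section Crossover

variable {D : Type} {n T : ℕ} (P : BranchingProgram D n T)

theorem node_succ (x : Fin n → D) (t : Fin T) :
    P.node x t.succ =
      P.next t (P.node x t.castSucc) (x (P.query t (P.node x t.castSucc))) := by
  simp only [node, Fin.induction_succ]

/-- The coordinate that the computation of `P` on input `x` queries at time `t`. -/
def queryAt (x : Fin n → D) (t : Fin T) : Fin n := P.query t (P.node x t.castSucc)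

theorem node_succ_congr {x z : Fin n → D} {t : Fin T}
    (hnode : P.node z t.castSucc = P.node x t.castSucc)
    (hquery : z (P.queryAt x t) = x (P.queryAt x t)) : P.node z t.succ = P.node x t.succ := by
  rw [node_succ, node_succ, hnode]
  exact congrArg _ hquery

theorem eval_eq_of_forall_queryAt {x z : Fin n → D}
    (h : ∀ t, z (P.queryAt x t) = x (P.queryAt x t)) : P.eval z = P.eval x := by
  have hnode (t : Fin (T + 1)) : P.node z t = P.node x t := by
    induction t using Fin.induction with
    | zero => rfl
    | succ t ih => exact P.node_succ_congr ih (h t)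
  rw [eval, eval, hnode]

variable {σ : Type} [DecidableEq σ]

theorem node_crossover {seg : Fin (T + 1) → σ} {E : Finset σ} {x y z : Fin n → D}
    (hboundary : ∀ t ∈ segmentBoundary seg, P.node x t = P.node y t)
    (hx : ∀ t : Fin T, seg t.castSucc ∈ E → z (P.queryAt x t) = x (P.queryAt x t))
    (hy : ∀ t : Fin T, seg t.castSucc ∉ E → z (P.queryAt y t) = y (P.queryAt y t))
    (t : Fin (T + 1)) : P.node z t = if seg t ∈ E then P.node x t else P.node y t := by
  induction t using Fin.induction with
  | zero => exact (P.eq_root _).trans (P.eq_root _).symm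
  | succ t ih =>
    have hstep : P.node z t.succ =
        if seg t.castSucc ∈ E then P.node x t.succ else P.node y t.succ := by
      split_ifs with hE
      · exact P.node_succ_congr (ih.trans (if_pos hE)) (hx t hE)
      · exact P.node_succ_congr (ih.trans (if_neg hE)) (hy t hE)
    by_cases ht : seg t.succ = seg t.castSucc
    · rw [hstep, ht]
    · rw [hstep, hboundary _ (succ_mem_segmentBoundary.2 ht), ite_self, ite_self]

/-- The segments during which the coordinate `i` is read on input `x`. -/
def readSegments (seg : Fin (T + 1) → σ) (x : Fin n → D) (i : Fin n) : Finset σ :=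
  ({t | P.queryAt x t = i} : Finset (Fin T)).image fun t => seg t.castSucc

theorem seg_mem_readSegments (seg : Fin (T + 1) → σ) (x : Fin n → D) (t : Fin T) :
    seg t.castSucc ∈ P.readSegments seg x (P.queryAt x t) :=
  mem_image_of_mem (fun t : Fin T => seg t.castSucc) (by simp)

theorem sum_card_readSegments_le (seg : Fin (T + 1) → σ) (x : Fin n → D) :
    ∑ i, #(P.readSegments seg x i) ≤ T := by
  calc ∑ i, #(P.readSegments seg x i) ≤ ∑ i, #{t : Fin T | P.queryAt x t = i} :=
        sum_le_sum fun i _ => card_image_le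
    _ = T := by
        rw [← card_eq_sum_card_fiberwise fun _ _ => mem_coe.2 (mem_univ _), card_univ,
          Fintype.card_fin]

theorem card_filter_mem_readSegments_le {seg : Fin (T + 1) → σ} (x : Fin n → D) {s : σ} {h : ℕ}
    (hs : #{t : Fin T | seg t.castSucc = s} ≤ h) : #{i | s ∈ P.readSegments seg x i} ≤ h := by
  refine (card_le_card fun i hi => ?_).trans ((card_image_le (f := P.queryAt x)).trans hs)
  obtain ⟨t, ht, hts⟩ := mem_image.1 (mem_filter.1 hi).2
  exact mem_image.2 ⟨t, by simpa using hts, (mem_filter.1 ht).2⟩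

/-- The classes into which the inputs are sorted: on input `x` the coordinates in `A` are read only
during segments of `E`, those in `B` only during segments outside `E`, and the computation enters
new segments at the nodes prescribed by `v`. -/
structure HasProfile (seg : Fin (T + 1) → σ) (E : Finset σ) (A B : Finset (Fin n))
    (v : ∀ t : segmentBoundary seg, P.Layer t) (x : Fin n → D) : Prop where
  readSegments_subset : ∀ i ∈ A, P.readSegments seg x i ⊆ E
  disjoint_readSegments : ∀ i ∈ B, Disjoint (P.readSegments seg x i) E
  node_eq : ∀ t : segmentBoundary seg, P.node x t = v t

variable {P} {seg : Fin (T + 1) → σ} {E : Finset σ} {A B : Finset (Fin n)}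
  {v : ∀ t : segmentBoundary seg, P.Layer t}

-- The computation on the spliced input follows that of `x` during the segments of `E` and that of
-- `y` during the others.
theorem HasProfile.eval_piecewise {x y : Fin n → D} (hx : P.HasProfile seg E A B v x)
    (hy : P.HasProfile seg E A B v y) (hagree : ∀ i ∉ A ∪ B, x i = y i)
    (heval : P.eval x = P.eval y) : P.eval (B.piecewise y x) = P.eval x := by
  have hnode := P.node_crossover (z := B.piecewise y x)
    (fun t ht => (hx.node_eq ⟨t, ht⟩).trans (hy.node_eq ⟨t, ht⟩).symm)
    (fun t ht => piecewise_eq_of_notMem _ _ _ fun hB =>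
      disjoint_left.1 (hx.disjoint_readSegments _ hB) (P.seg_mem_readSegments seg x t) ht)
    (fun t ht => by
      by_cases hB : P.queryAt y t ∈ B
      · exact piecewise_eq_of_mem _ _ _ hB
      · have hA : P.queryAt y t ∉ A := fun hA =>
          ht (hy.readSegments_subset _ hA (P.seg_mem_readSegments seg y t))
        rw [piecewise_eq_of_notMem _ _ _ hB]
        exact hagree _ (notMem_union.2 ⟨hA, hB⟩)) (Fin.last T)
  rw [eval, hnode]
  split_ifs
  · rfl
  · exact heval.symm

end Crossover

section Counting

variable {D : Type} {n T : ℕ} {P : BranchingProgram D n T} {r : D → D → Prop} {w : ℝ}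

/-- `P` outputs `false` only on inputs no two coordinates of which are related by `r`. -/
def RejectsOnlyUnrelated (P : BranchingProgram D n T) (r : D → D → Prop) : Prop :=
  ∀ x, P.eval x = false → Pairwise fun i j => ¬ r (x i) (x j)

theorem RejectsOnlyUnrelated.le_length (hP : P.RejectsOnlyUnrelated r) (hr : ∀ a, r a a)
    (hn : 2 ≤ n) {x : Fin n → D} (hx : P.eval x = false) : n ≤ T := by
  by_contra! hT
  obtain ⟨i, hi⟩ : ∃ i, ∀ t, P.queryAt x t ≠ i := by
    by_contra! hsurj
    have := Fintype.card_le_of_surjective (P.queryAt x) hsurj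
    simp only [Fintype.card_fin] at this
    lia
  have : Nontrivial (Fin n) := Fin.nontrivial_iff_two_le.2 hn
  obtain ⟨j, hj⟩ := exists_ne i
  have heval : P.eval (Function.update x i (x j)) = P.eval x :=
    P.eval_eq_of_forall_queryAt fun t => Function.update_of_ne (hi t) _ _
  have hunrel := hP _ (heval.trans hx) hj.symm
  simp only [Function.update_self, Function.update_of_ne hj] at hunrel
  exact hunrel (hr _)

variable [Fintype D] {σ : Type} [DecidableEq σ] {seg : Fin (T + 1) → σ} {m : ℕ}

open Classical in
theorem RejectsOnlyUnrelated.card_hasProfile_le (hP : P.RejectsOnlyUnrelated r)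
    (hw : NoLargeUnrelatedPair r w) {E : Finset σ} {A B : Finset (Fin n)} (hAB : Disjoint A B)
    (hA : #A = m) (hB : #B = m) (v : ∀ t : segmentBoundary seg, P.Layer t) :
    (#{x | P.eval x = false ∧ P.HasProfile seg E A B v x} : ℝ) ≤
      w ^ m * Fintype.card D ^ (n - m) := by
  refine (hw.card_le hAB hA hB fun x hx y hy hagree i hi j hj => ?_).trans_eq
    (by rw [Fintype.card_fin])
  obtain ⟨hxeval, hx⟩ := (mem_filter.1 hx).2
  obtain ⟨hyeval, hy⟩ := (mem_filter.1 hy).2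
  have hiB : i ∉ B := disjoint_left.1 hAB hi
  have hunrel := hP _ ((hx.eval_piecewise hy hagree (hxeval.trans hyeval.symm)).trans hxeval)
    (ne_of_mem_of_not_mem hj hiB).symm
  simpa only [piecewise_eq_of_notMem _ _ _ hiB, piecewise_eq_of_mem _ _ _ hj] using hunrel

open Classical in
theorem RejectsOnlyUnrelated.card_rejected_le_of_split [Fintype σ] (hP : P.RejectsOnlyUnrelated r)
    (hw : NoLargeUnrelatedPair r w)
    (hsplit : ∀ x, ∃ (E : Finset σ) (A B : Finset (Fin n)), #A = m ∧ #B = m ∧ Disjoint A B ∧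
      (∀ i ∈ A, P.readSegments seg x i ⊆ E) ∧ ∀ i ∈ B, Disjoint (P.readSegments seg x i) E) :
    (#{x | P.eval x = false} : ℝ) ≤
      2 ^ Fintype.card σ * (n.choose m) ^ 2 *
        (∏ t ∈ segmentBoundary seg, (Fintype.card (P.Layer t) : ℝ)) *
          (w ^ m * Fintype.card D ^ (n - m)) := by
  let splits : Finset (Finset (Fin n) × Finset (Fin n)) :=
    {p ∈ powersetCard m univ ×ˢ powersetCard m univ | Disjoint p.1 p.2}
  let profiles : Finset (Finset σ × (Finset (Fin n) × Finset (Fin n)) ×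
      (∀ t : segmentBoundary seg, P.Layer t)) := univ ×ˢ splits ×ˢ univ
  have hcover : ({x | P.eval x = false} : Finset (Fin n → D)) ⊆ profiles.biUnion fun k =>
      {x | P.eval x = false ∧ P.HasProfile seg k.1 k.2.1.1 k.2.1.2 k.2.2 x} := by
    intro x hx
    obtain ⟨E, A, B, hA, hB, hAB, hsub, hdisj⟩ := hsplit x
    refine mem_biUnion.2 ⟨(E, (A, B), fun t => P.node x t), ?_, ?_⟩
    · simp [profiles, splits, hA, hB, hAB]
    · exact mem_filter.2 ⟨mem_univ _, (mem_filter.1 hx).2, hsub, hdisj, fun _ => rfl⟩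
  have hprofiles : (#profiles : ℝ) ≤ 2 ^ Fintype.card σ * (n.choose m) ^ 2 *
      ∏ t ∈ segmentBoundary seg, (Fintype.card (P.Layer t) : ℝ) := by
    have hsplits : #splits ≤ n.choose m ^ 2 := by
      refine (card_filter_le _ _).trans_eq ?_
      rw [card_product, card_powersetCard, card_univ, Fintype.card_fin, sq]
    have hcard : #profiles =
        2 ^ Fintype.card σ * (#splits * ∏ t ∈ segmentBoundary seg, Fintype.card (P.Layer t)) := by
      simp only [profiles, card_product, card_univ, Fintype.card_finset, Fintype.card_pi]
      rw [prod_coe_sort (segmentBoundary seg) fun t => Fintype.card (P.Layer t)]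
    rw [hcard, ← mul_assoc]
    push_cast
    gcongr
    exact_mod_cast hsplits
  calc (#{x | P.eval x = false} : ℝ)
      ≤ ∑ k ∈ profiles,
          (#{x | P.eval x = false ∧ P.HasProfile seg k.1 k.2.1.1 k.2.1.2 k.2.2 x} : ℝ) := by
        exact_mod_cast (card_le_card hcover).trans card_biUnion_le
    _ ≤ #profiles • (w ^ m * Fintype.card D ^ (n - m)) :=
        sum_le_card_nsmul _ _ _ fun k hk => by
          simp only [profiles, splits, mem_product, mem_filter, mem_powersetCard_univ] at hk
          exact hP.card_hasProfile_le hw hk.2.1.2 hk.2.1.1.1 hk.2.1.1.2 _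
    _ ≤ _ := by
        rw [nsmul_eq_mul]
        exact mul_le_mul_of_nonneg_right hprofiles
          (mul_nonneg (pow_nonneg hw.nonneg m) (by positivity))

end Counting

section Tradeoff

variable {D : Type} {n T : ℕ} {P : BranchingProgram D n T} {r : D → D → Prop} {w : ℝ}

theorem logb_card_layer_nonneg (P : BranchingProgram D n T) (t : Fin (T + 1)) :
    0 ≤ Real.logb 2 (Fintype.card (P.Layer t)) := by
  rcases Nat.eq_zero_or_pos (Fintype.card (P.Layer t)) with h | h
  · simp [h]
  · exact Real.logb_nonneg one_lt_two (Nat.one_le_cast.2 h)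

theorem cumulativeMemory_nonneg (P : BranchingProgram D n T) : 0 ≤ P.cumulativeMemory :=
  sum_nonneg fun t _ => P.logb_card_layer_nonneg t

theorem one_le_cumulativeMemory_of_eval_ne {x y : Fin n → D} (hxy : P.eval x ≠ P.eval y) :
    1 ≤ P.cumulativeMemory := by
  have hcard : 1 < Fintype.card (P.Layer (Fin.last T)) :=
    Fintype.one_lt_card_iff.2 ⟨_, _, fun h => hxy (congrArg P.output h)⟩
  calc (1 : ℝ) = Real.logb 2 2 := (Real.logb_self_eq_one one_lt_two).symm
    _ ≤ Real.logb 2 (Fintype.card (P.Layer (Fin.last T))) :=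
        Real.logb_le_logb_of_le one_lt_two two_pos (by exact_mod_cast hcard)
    _ ≤ P.cumulativeMemory :=
        single_le_sum (f := fun t => Real.logb 2 (Fintype.card (P.Layer t)))
          (fun t _ => P.logb_card_layer_nonneg t) (mem_univ _)

theorem prod_card_layer_le (P : BranchingProgram D n T) (s : Finset (Fin (T + 1))) :
    ∏ t ∈ s, (Fintype.card (P.Layer t) : ℝ) ≤
      2 ^ ∑ t ∈ s, Real.logb 2 (Fintype.card (P.Layer t)) := by
  rw [Real.rpow_sum_of_pos two_pos]
  refine prod_le_prod (fun t _ => Nat.cast_nonneg _) fun t _ => ?_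
  rcases Nat.eq_zero_or_pos (Fintype.card (P.Layer t)) with h | h
  · simp [h]
  · exact (Real.rpow_logb two_pos (by norm_num) (Nat.cast_pos.2 h)).ge

variable [Fintype D] {h K m : ℕ}

open Classical in
theorem RejectsOnlyUnrelated.card_rejected_le (hP : P.RejectsOnlyUnrelated r)
    (hw : NoLargeUnrelatedPair r w) (hn : 1 ≤ n) (hh : 1 ≤ h) (hK : 1 ≤ K) (hTK : T ≤ K * n)
    (hTh : 8 * (T * h) ≤ n ^ 2) (hm : 16 * m * 16 ^ K ≤ n) :
    (#{x | P.eval x = false} : ℝ) ≤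
      2 ^ (T / h + 2) * (n.choose m) ^ 2 * 2 ^ (P.cumulativeMemory / h) *
        (w ^ m * Fintype.card D ^ (n - m)) := by
  obtain ⟨seg, hseg, hsum⟩ := exists_segmentation hh P.logb_card_layer_nonneg
  have : Nonempty (Fin n) := ⟨⟨0, hn⟩⟩
  have hsplit (x : Fin n → D) := exists_card_eq_subset_disjoint (S := P.readSegments seg x)
    (m := m) (h := h) (T := T) hK (P.sum_card_readSegments_le seg x)
    (by rwa [Fintype.card_fin]) (fun s => P.card_filter_mem_readSegments_le x (hseg s))
    (by rwa [Fintype.card_fin]) (by rwa [Fintype.card_fin])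
  have hboundary : ∏ t ∈ segmentBoundary seg, (Fintype.card (P.Layer t) : ℝ) ≤
      2 ^ (P.cumulativeMemory / h) := by
    refine (P.prod_card_layer_le _).trans (Real.rpow_le_rpow_of_exponent_le one_le_two ?_)
    rwa [le_div_iff₀ (by exact_mod_cast hh), mul_comm]
  refine (hP.card_rejected_le_of_split hw hsplit).trans ?_
  rw [Fintype.card_fin]
  have := hw.nonneg
  gcongr

open Classical in
theorem RejectsOnlyUnrelated.mul_logb_sub_le [Nonempty D] (hP : P.RejectsOnlyUnrelated r)
    (hw : NoLargeUnrelatedPair r w) (hw₀ : 0 < w)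
    (hcard : Fintype.card D ^ n ≤ 2 * #{x | P.eval x = false}) (hh : 1 ≤ h) (hK : 1 ≤ K)
    (hTK : T ≤ K * n) (hTh : 8 * (T * h) ≤ n ^ 2) (hm₁ : 1 ≤ m) (hm : 16 * m * 16 ^ K ≤ n)
    (hmn : n ≤ 32 * m * 16 ^ K) :
    m * (Real.logb 2 (Fintype.card D / w) - 8 * K - 14) ≤
      (T / h : ℕ) + 3 + P.cumulativeMemory / h := by
  have hD : (0 : ℝ) < Fintype.card D := Nat.cast_pos.2 Fintype.card_pos
  have hm_le : m ≤ n := by nlinarith [Nat.one_le_pow K 16 (by norm_num)]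
  have hchoose : (n.choose m : ℝ) ≤ 2 ^ ((4 * K + 7) * m) := by
    refine mod_cast choose_le_two_pow_mul (b := 4 * K + 5) (hmn.trans_eq ?_)
    rw [pow_add, pow_mul]
    ring
  have hrejected := hP.card_rejected_le hw (by lia) hh hK hTK hTh hm
  have hpow : ((Fintype.card D : ℝ) / w) ^ m ≤
      2 ^ (T / h + 3) * (2 ^ ((4 * K + 7) * m)) ^ 2 * 2 ^ (P.cumulativeMemory / h) := by
    rw [div_pow, div_le_iff₀ (by positivity)]
    refine le_of_mul_le_mul_right ?_ (pow_pos hD (n - m))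
    calc (Fintype.card D : ℝ) ^ m * Fintype.card D ^ (n - m) = Fintype.card D ^ n := by
          rw [← pow_add, Nat.add_sub_cancel' hm_le]
      _ ≤ 2 * #{x | P.eval x = false} := by exact_mod_cast hcard
      _ ≤ 2 * (2 ^ (T / h + 2) * (2 ^ ((4 * K + 7) * m)) ^ 2 * 2 ^ (P.cumulativeMemory / h) *
            (w ^ m * Fintype.card D ^ (n - m))) := by
          refine mul_le_mul_of_nonneg_left (hrejected.trans ?_) two_pos.le
          gcongr
      _ = 2 ^ (T / h + 3) * (2 ^ ((4 * K + 7) * m)) ^ 2 * 2 ^ (P.cumulativeMemory / h) * w ^ m *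
            Fintype.card D ^ (n - m) := by ring
  have hlog := Real.logb_le_logb_of_le one_lt_two (by positivity) hpow
  rw [Real.logb_mul (by positivity) (by positivity), Real.logb_mul (by positivity) (by positivity),
    Real.logb_pow, Real.logb_pow, Real.logb_pow, Real.logb_pow,
    Real.logb_rpow two_pos (by norm_num), Real.logb_self_eq_one one_lt_two] at hlog
  push_cast at hlog ⊢
  linarith

theorem exists_segment_length_and_set_size (hK : 1 ≤ K) (hTK : T ≤ K * n)
    (hn : 2 ^ (6 * K + 10) ≤ n) :
    ∃ h m, 1 ≤ h ∧ 1 ≤ m ∧ 8 * (T * h) ≤ n ^ 2 ∧ 16 * m * 16 ^ K ≤ n ∧ n ≤ 32 * m * 16 ^ K ∧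
      T / h + 3 ≤ m ∧ n ^ 2 ≤ 2 ^ (5 * K + 9) * (h * m) := by
  have hK₂ : K ≤ 2 ^ K := Nat.lt_two_pow_self.le
  have h16 : 16 ^ K = 2 ^ (4 * K) := by rw [pow_mul]; norm_num
  obtain ⟨h, hh, hhn, hnh⟩ := exists_mul_le_and_le_two_mul (a := 8 * K) (b := n) (by lia) (by
    calc 8 * K ≤ 2 ^ 3 * 2 ^ K := by lia
      _ = 2 ^ (K + 3) := by ring
      _ ≤ 2 ^ (6 * K + 10) := Nat.pow_le_pow_right two_pos (by lia)
      _ ≤ n := hn)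
  obtain ⟨m, hm, hmn, hnm⟩ := exists_mul_le_and_le_two_mul (a := 2 ^ (4 * K + 4)) (b := n)
    (by positivity) ((Nat.pow_le_pow_right two_pos (by lia)).trans hn)
  rw [pow_add, ← h16] at hmn hnm
  have hlarge : 2 ^ (2 * K + 5) ≤ m := by
    refine le_of_mul_le_mul_left (a := 2 ^ (4 * K + 5)) ?_ (by positivity)
    calc 2 ^ (4 * K + 5) * 2 ^ (2 * K + 5) = 2 ^ (6 * K + 10) := by ring
      _ ≤ n := hn
      _ ≤ 2 ^ (4 * K + 5) * m := by rw [pow_succ, pow_add, ← h16]; linarith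
  have hsegments : T / h + 3 ≤ m := by
    have hdiv : T / h ≤ 16 * K ^ 2 := Nat.div_le_of_le_mul (by nlinarith)
    have hsq : K ^ 2 ≤ (2 ^ K) ^ 2 := Nat.pow_le_pow_left hK₂ 2
    have : 2 ^ (2 * K + 5) = 32 * (2 ^ K) ^ 2 := by ring
    nlinarith [Nat.one_le_two_pow (n := K)]
  refine ⟨h, m, hh, hm, ?_, by linarith, by linarith, hsegments, ?_⟩
  · calc 8 * (T * h) ≤ 8 * (K * n * h) := by gcongr
      _ = n * (8 * K * h) := by ring
      _ ≤ n ^ 2 := by rw [sq]; gcongr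
  · calc n ^ 2 = n * n := sq n
      _ ≤ 2 * (8 * K * h) * (2 * (16 ^ K * 2 ^ 4 * m)) := Nat.mul_le_mul hnh hnm
      _ ≤ 2 * (8 * 2 ^ K * h) * (2 * (2 ^ (4 * K) * 2 ^ 4 * m)) := by rw [h16]; gcongr
      _ = 2 ^ (5 * K + 9) * (h * m) := by ring

open Classical in
theorem RejectsOnlyUnrelated.sq_mul_le_cumulativeMemory [Nonempty D]
    (hP : P.RejectsOnlyUnrelated r) (hw : NoLargeUnrelatedPair r w) (hw₀ : 0 < w)
    (hcard : Fintype.card D ^ n ≤ 2 * #{x | P.eval x = false}) (hK : 1 ≤ K)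
    (hTK : T ≤ K * n) (hn : 2 ^ (6 * K + 10) ≤ n) :
    n ^ 2 * (Real.logb 2 (Fintype.card D / w) - 8 * K - 15) ≤
      2 ^ (5 * K + 9) * P.cumulativeMemory := by
  obtain ⟨h, m, hh, hm, hTh, hmn, hnm, hsegments, hn_sq⟩ :=
    exists_segment_length_and_set_size hK hTK hn
  have hlog := hP.mul_logb_sub_le hw hw₀ hcard hh hK hTK hTh hm hmn hnm
  set X : ℝ := Real.logb 2 (Fintype.card D / w) - 8 * K - 15 with hX
  rcases le_or_gt X 0 with hX₀ | hX₀
  · exact (mul_nonpos_of_nonneg_of_nonpos (by positivity) hX₀).trans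
      (mul_nonneg (by positivity) P.cumulativeMemory_nonneg)
  have hmX : h * m * X ≤ P.cumulativeMemory := by
    have hsegments' : ((T / h : ℕ) : ℝ) + 3 ≤ m := by exact_mod_cast hsegments
    have : m * X ≤ P.cumulativeMemory / h := by rw [hX]; linarith
    rw [le_div_iff₀ (by exact_mod_cast hh)] at this
    linarith
  calc (n : ℝ) ^ 2 * X ≤ 2 ^ (5 * K + 9) * (h * m) * X := by
        gcongr
        exact_mod_cast hn_sq
    _ = 2 ^ (5 * K + 9) * (h * m * X) := by ring
    _ ≤ 2 ^ (5 * K + 9) * P.cumulativeMemory := by gcongr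

end Tradeoff

end BranchingProgram

section HammingCloseness

variable {γ β : ℝ} {n N T : ℕ}

theorem noLargeUnrelatedPair_hammingClose (hγ : 0 ≤ γ) (hN : 2 ≤ N) :
    NoLargeUnrelatedPair (HammingClose γ N) (2 * (N : ℝ) ^ (1 - γ ^ 2 / 4)) := by
  intro A B h
  by_contra! hlarge
  have := card_mul_card_le_of_not_hammingClose hγ hN h
  nlinarith [Real.rpow_nonneg (Nat.cast_nonneg (α := ℝ) N) (1 - γ ^ 2 / 4)]

theorem card_pow_le_two_mul_card_hammingCloseness_eq_false (hγ₀ : 0 < γ) (hγ : γ ≤ 1 / 2)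
    (hN : 0 < N) (hnN : 4 * (n : ℝ) ^ 2 ≤ N ^ (1 - Real.binEntropy γ / Real.log 2)) :
    N ^ n ≤ 2 * #{x | hammingCloseness γ n N x = false} := by
  classical
  have hN₀ : (0 : ℝ) < N := Nat.cast_pos.2 hN
  have : Nonempty (Fin N) := ⟨⟨0, hN⟩⟩
  set V := ⌊2 * (N : ℝ) ^ (Real.binEntropy γ / Real.log 2)⌋₊
  have hV (a : Fin N) : #{b | HammingClose γ N a b} ≤ V :=
    Nat.le_floor (card_hammingClose_le hγ₀ hγ a)
  have hcard : 2 * Fintype.card (Fin n) ^ 2 * V ≤ Fintype.card (Fin N) := by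
    rw [Fintype.card_fin, Fintype.card_fin, ← Nat.cast_le (α := ℝ)]
    push_cast
    calc 2 * (n : ℝ) ^ 2 * V ≤ 2 * n ^ 2 * (2 * (N : ℝ) ^ (Real.binEntropy γ / Real.log 2)) := by
          gcongr
          exact Nat.floor_le (by positivity)
      _ = 4 * n ^ 2 * (N : ℝ) ^ (Real.binEntropy γ / Real.log 2) := by ring
      _ ≤ (N : ℝ) ^ (1 - Real.binEntropy γ / Real.log 2) *
            (N : ℝ) ^ (Real.binEntropy γ / Real.log 2) := by gcongr
      _ = N := by rw [← Real.rpow_add hN₀, sub_add_cancel, Real.rpow_one]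
  simpa only [Fintype.card_fin, hammingCloseness_eq_false_iff]
    using card_pow_le_two_mul_card_pairwise_not_rel hV hcard

theorem four_mul_sq_le_of_le_rpow (hγ₀ : 0 < γ) (hγ : γ ≤ 1 / 2) (hn : 1 ≤ n)
    (hnN : 4 * (n : ℝ) ^ 2 ≤ N ^ (1 - Real.binEntropy γ / Real.log 2)) :
    4 * (n : ℝ) ^ 2 ≤ N := by
  have hn₁ : (1 : ℝ) ≤ n := by exact_mod_cast hn
  rcases Nat.eq_zero_or_pos N with rfl | hN
  · have := hnN.trans (by exact_mod_cast Real.zero_rpow_le_one _)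
    nlinarith
  refine hnN.trans (Real.rpow_le_self_of_one_le (by exact_mod_cast hN) ?_)
  have := div_nonneg (Real.binEntropy_nonneg hγ₀.le (by linarith)) (Real.log_nonneg one_le_two)
  linarith

theorem sq_mul_logb_le_two_rpow {c : ℝ} (hn : 1 ≤ n) (hc : 3 * Real.logb 2 n ≤ c) :
    n ^ 2 * Real.logb 2 n ≤ 2 ^ c := by
  have hn₀ : (0 : ℝ) < n := by exact_mod_cast hn
  have hlog : Real.logb 2 n ≤ n := by
    rw [Real.logb_le_iff_le_rpow one_lt_two hn₀, Real.rpow_natCast]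
    exact_mod_cast Nat.lt_two_pow_self.le
  calc (n : ℝ) ^ 2 * Real.logb 2 n ≤ n ^ 2 * n := by gcongr
    _ = (2 ^ Real.logb 2 n) ^ 3 := by
        rw [Real.rpow_logb two_pos (by norm_num) hn₀, pow_succ _ 2]
    _ = 2 ^ (3 * Real.logb 2 n) := by
        rw [← Real.rpow_natCast, ← Real.rpow_mul two_pos.le, mul_comm]; norm_num
    _ ≤ 2 ^ c := Real.rpow_le_rpow_of_exponent_le one_le_two hc

namespace BranchingProgram

variable {P : BranchingProgram (Fin N) n T}

theorem Computes.rejectsOnlyUnrelated (hP : P.Computes (hammingCloseness γ n N)) :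
    P.RejectsOnlyUnrelated (HammingClose γ N) :=
  fun x hx => hammingCloseness_eq_false_iff.1 ((hP x).symm.trans hx)

theorem Computes.exists_eval_eq_false (hP : P.Computes (hammingCloseness γ n N)) (hγ₀ : 0 < γ)
    (hγ : γ ≤ 1 / 2) (hN : 0 < N)
    (hnN : 4 * (n : ℝ) ^ 2 ≤ N ^ (1 - Real.binEntropy γ / Real.log 2)) :
    ∃ x, P.eval x = false := by
  have hcard := card_pow_le_two_mul_card_hammingCloseness_eq_false hγ₀ hγ hN hnN
  obtain ⟨x, hx⟩ := card_pos.1 (Nat.pos_of_mul_pos_left ((pow_pos hN n).trans_le hcard))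
  exact ⟨x, (hP x).trans (mem_filter.1 hx).2⟩

theorem Computes.one_le_cumulativeMemory (hP : P.Computes (hammingCloseness γ n N))
    (hγ : 0 ≤ γ) (hn : 2 ≤ n) {x : Fin n → Fin N} (hx : P.eval x = false) :
    1 ≤ P.cumulativeMemory := by
  let i : Fin n := ⟨0, by lia⟩
  let j : Fin n := ⟨1, by lia⟩
  refine one_le_cumulativeMemory_of_eval_ne (x := x) (y := fun _ => x i) fun h => ?_
  exact hP.rejectsOnlyUnrelated _ (h.symm.trans hx) (i := i) (j := j) (by simp [i, j])
    (hammingClose_self hγ _)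

theorem Computes.sq_mul_sub_le_cumulativeMemory (hP : P.Computes (hammingCloseness γ n N))
    (hγ₀ : 0 < γ) (hγ : γ ≤ 1 / 2) (hn : 1 ≤ n)
    (hnN : 4 * (n : ℝ) ^ 2 ≤ N ^ (1 - Real.binEntropy γ / Real.log 2)) {K : ℕ} (hK : 1 ≤ K)
    (hTK : T ≤ K * n) (hKn : 2 ^ (6 * K + 10) ≤ n) :
    n ^ 2 * (γ ^ 2 / 2 * Real.logb 2 n - 8 * K - 16) ≤ 2 ^ (5 * K + 9) * P.cumulativeMemory := by
  have hn₁ : (1 : ℝ) ≤ n := by exact_mod_cast hn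
  have hsq_le := four_mul_sq_le_of_le_rpow hγ₀ hγ hn hnN
  have hN₂ : 2 ≤ N := by
    have : (2 : ℝ) ≤ N := by nlinarith
    exact_mod_cast this
  have hN₀ : (0 : ℝ) < N := by positivity
  have : Nonempty (Fin N) := ⟨⟨0, by lia⟩⟩
  have hlogN : 2 * Real.logb 2 n ≤ Real.logb 2 N := by
    rw [← Nat.cast_ofNat, ← Real.logb_pow]
    exact Real.logb_le_logb_of_le one_lt_two (by positivity) (by nlinarith)
  have hgap : Real.logb 2 (N / (2 * (N : ℝ) ^ (1 - γ ^ 2 / 4))) =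
      γ ^ 2 / 4 * Real.logb 2 N - 1 := by
    rw [Real.logb_div (by positivity) (by positivity),
      Real.logb_mul two_ne_zero (by positivity), Real.logb_self_eq_one one_lt_two,
      Real.logb_rpow_eq_mul_logb_of_pos hN₀]
    ring
  have hcard : Fintype.card (Fin N) ^ n ≤ 2 * #{x | P.eval x = false} := by
    simpa only [Fintype.card_fin, hP _]
      using card_pow_le_two_mul_card_hammingCloseness_eq_false hγ₀ hγ (by lia) hnN
  have hmain := hP.rejectsOnlyUnrelated.sq_mul_le_cumulativeMemory
    (noLargeUnrelatedPair_hammingClose hγ₀.le hN₂) (by positivity) (by convert hcard) hK hTK hKn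
  rw [Fintype.card_fin, hgap] at hmain
  have hgap_le := mul_le_mul_of_nonneg_left hlogN (by positivity : 0 ≤ γ ^ 2 / 4)
  exact (mul_le_mul_of_nonneg_left (by linarith) (by positivity)).trans hmain

theorem Computes.sq_mul_logb_le_cumulativeMemory (hP : P.Computes (hammingCloseness γ n N))
    (hγ₀ : 0 < γ) (hγ : γ ≤ 1 / 2) (hn : 1 ≤ n)
    (hnN : 4 * (n : ℝ) ^ 2 ≤ N ^ (1 - Real.binEntropy γ / Real.log 2)) {k : ℝ} (hk : 1 ≤ k)
    (hTk : T ≤ k * n) (hkn : 32 * k ≤ γ ^ 2 / 4 * Real.logb 2 n) :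
    n ^ 2 * (γ ^ 2 / 4 * Real.logb 2 n) ≤ 2 ^ (19 * k) * P.cumulativeMemory := by
  have hn₀ : (0 : ℝ) < n := by exact_mod_cast hn
  have hceil : (⌈k⌉₊ : ℝ) ≤ 2 * k := by linarith [Nat.ceil_lt_add_one (zero_le_one.trans hk)]
  have hTceil : T ≤ ⌈k⌉₊ * n := by
    have : (T : ℝ) ≤ ⌈k⌉₊ * n := hTk.trans (by gcongr; exact Nat.le_ceil k)
    exact_mod_cast this
  have hpow : 2 ^ (6 * ⌈k⌉₊ + 10) ≤ n := by
    have hlog : γ ^ 2 / 4 * Real.logb 2 n ≤ Real.logb 2 n :=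
      mul_le_of_le_one_left (Real.logb_nonneg one_lt_two (by exact_mod_cast hn)) (by nlinarith)
    have : ((6 * ⌈k⌉₊ + 10 : ℕ) : ℝ) ≤ Real.logb 2 n := by
      push_cast
      linarith
    rw [Real.le_logb_iff_rpow_le one_lt_two hn₀, Real.rpow_natCast] at this
    exact_mod_cast this
  calc (n : ℝ) ^ 2 * (γ ^ 2 / 4 * Real.logb 2 n)
      ≤ n ^ 2 * (γ ^ 2 / 2 * Real.logb 2 n - 8 * ⌈k⌉₊ - 16) := by
        gcongr
        linarith
    _ ≤ 2 ^ (5 * ⌈k⌉₊ + 9) * P.cumulativeMemory :=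
        hP.sq_mul_sub_le_cumulativeMemory hγ₀ hγ hn hnN (Nat.one_le_ceil_iff.2 (by linarith))
          hTceil hpow
    _ ≤ 2 ^ (19 * k) * P.cumulativeMemory := by
        refine mul_le_mul_of_nonneg_right ?_ P.cumulativeMemory_nonneg
        rw [← Real.rpow_natCast]
        refine Real.rpow_le_rpow_of_exponent_le one_le_two ?_
        push_cast
        linarith

-- For `T / n ≥ γ² log₂ n / 128` the left-hand side is at most `1`.
theorem Computes.sq_mul_logb_div_le_cumulativeMemory
    (hP : P.Computes (hammingCloseness γ n N)) (hγ₀ : 0 < γ) (hγ : γ ≤ 1 / 2) (hn : 2 ≤ n)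
    (hnN : 4 * (n : ℝ) ^ 2 ≤ N ^ (1 - Real.binEntropy γ / Real.log 2)) :
    n ^ 2 * Real.logb 2 n / 2 ^ (384 / γ ^ 2 * (T / n)) ≤ P.cumulativeMemory := by
  have hn₀ : (0 : ℝ) < n := by positivity
  have hsq_le := four_mul_sq_le_of_le_rpow hγ₀ hγ (by lia) hnN
  have hN : 0 < N := Nat.cast_pos.1 (lt_of_lt_of_le (by positivity) hsq_le)
  obtain ⟨x, hx⟩ := hP.exists_eval_eq_false hγ₀ hγ hN hnN
  have hCM := hP.one_le_cumulativeMemory hγ₀.le hn hx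
  set k : ℝ := T / n with hk
  set c : ℝ := 4 / γ ^ 2 with hc
  have hk₁ : 1 ≤ k := by
    rw [hk, one_le_div hn₀]
    exact_mod_cast hP.rejectsOnlyUnrelated.le_length (hammingClose_self hγ₀.le) hn hx
  have hc₁₆ : 16 ≤ c := by
    rw [hc, le_div_iff₀ (by positivity)]
    nlinarith
  rw [div_le_iff₀ (by positivity), show 384 / γ ^ 2 * k = 96 * c * k by rw [hc]; ring]
  rcases le_or_gt (Real.logb 2 n) (32 * c * k) with hlong | hshort
  · calc (n : ℝ) ^ 2 * Real.logb 2 n ≤ 2 ^ (96 * c * k) :=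
          sq_mul_logb_le_two_rpow (by lia) (by linarith)
      _ ≤ P.cumulativeMemory * 2 ^ (96 * c * k) := le_mul_of_one_le_left (by positivity) hCM
  · have hkn : 32 * k ≤ γ ^ 2 / 4 * Real.logb 2 n := by
      calc 32 * k = γ ^ 2 / 4 * (32 * c * k) := by rw [hc]; field_simp
        _ ≤ γ ^ 2 / 4 * Real.logb 2 n := by gcongr
    have hc_le : c ≤ 2 ^ (c * k) := by
      have := one_add_mul_self_le_rpow_one_add (s := 1) (by norm_num) (p := c * k) (by nlinarith)
      norm_num at this
      nlinarith
    have hmain := hP.sq_mul_logb_le_cumulativeMemory hγ₀ hγ (by lia) hnN hk₁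
      (div_mul_cancel₀ _ hn₀.ne').ge hkn
    calc (n : ℝ) ^ 2 * Real.logb 2 n = c * (n ^ 2 * (γ ^ 2 / 4 * Real.logb 2 n)) := by
          rw [hc]; field_simp
      _ ≤ c * (2 ^ (19 * k) * P.cumulativeMemory) := by gcongr
      _ ≤ 2 ^ (c * k) * (2 ^ (19 * k) * P.cumulativeMemory) := by gcongr
      _ = P.cumulativeMemory * 2 ^ (c * k + 19 * k) := by rw [Real.rpow_add two_pos]; ring
      _ ≤ P.cumulativeMemory * 2 ^ (96 * c * k) := by
          gcongr
          · exact one_le_two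
          · nlinarith

end BranchingProgram

theorem eventually_sq_mul_logb_div_le_cumulativeMemory (hγ₀ : 0 < γ) (hγ : γ ≤ 1 / 2)
    (hβ : 2 < β * (1 - Real.binEntropy γ / Real.log 2)) :
    ∀ᶠ n : ℕ in atTop, ∀ N : ℕ, (n : ℝ) ^ β ≤ N → ∀ (T : ℕ) (P : BranchingProgram (Fin N) n T),
      P.Computes (hammingCloseness γ n N) →
        n ^ 2 * Real.logb 2 n / 2 ^ (384 / γ ^ 2 * (T / n)) ≤ P.cumulativeMemory := by
  set e := 1 - Real.binEntropy γ / Real.log 2 with he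
  have he₀ : 0 ≤ e := by
    rw [he, sub_nonneg, div_le_one (Real.log_pos one_lt_two)]
    exact Real.binEntropy_le_log_two
  have hgrowth : Tendsto (fun n : ℕ => (n : ℝ) ^ (β * e - 2)) atTop atTop :=
    (tendsto_rpow_atTop (by linarith)).comp tendsto_natCast_atTop_atTop
  filter_upwards [hgrowth.eventually_ge_atTop 4, eventually_ge_atTop 2] with n hn₄ hn N hnN T P hP
  have hn₀ : (0 : ℝ) < n := by positivity
  refine hP.sq_mul_logb_div_le_cumulativeMemory hγ₀ hγ hn ?_
  calc 4 * (n : ℝ) ^ 2 ≤ (n : ℝ) ^ (β * e - 2) * n ^ 2 := by gcongr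
    _ = ((n : ℝ) ^ β) ^ e := by
        rw [← Real.rpow_two, ← Real.rpow_add hn₀, sub_add_cancel, Real.rpow_mul hn₀.le]
    _ ≤ (N : ℝ) ^ e := by gcongr

end HammingCloseness

theorem exists_tendsto_zero_rpow_sub_le {C : ℝ} (hC : 0 ≤ C) {τ : ℕ → ℝ}
    (hτ : τ =o[atTop] fun n : ℕ => (n : ℝ) * Real.logb 2 n) :
    ∃ ε : ℕ → ℝ, Tendsto ε atTop (𝓝 0) ∧ ∀ᶠ n : ℕ in atTop, ∀ T : ℕ, (T : ℝ) ≤ τ n →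
      (n : ℝ) ^ (2 - ε n) ≤ n ^ 2 * Real.logb 2 n / 2 ^ (C * (T / n)) := by
  refine ⟨fun n => C * |τ n / (n * Real.logb 2 n)|, ?_, ?_⟩
  · simpa only [abs_zero, mul_zero] using hτ.tendsto_div_nhds_zero.abs.const_mul C
  filter_upwards [eventually_ge_atTop 2] with n hn T hT
  have hn₀ : (0 : ℝ) < n := by positivity
  have hlog : 1 ≤ Real.logb 2 n := by
    rw [Real.le_logb_iff_rpow_le one_lt_two hn₀, Real.rpow_one]
    exact_mod_cast hn
  have hexp : C * (T / n) ≤ Real.logb 2 n * (C * |τ n / (n * Real.logb 2 n)|) := by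
    calc C * (T / n) ≤ C * (|τ n| / n) := by
          gcongr
          exact hT.trans (le_abs_self _)
      _ = Real.logb 2 n * (C * |τ n / (n * Real.logb 2 n)|) := by
          rw [abs_div, abs_of_pos (by positivity : 0 < n * Real.logb 2 n)]
          field_simp
  have hpow : (2 : ℝ) ^ (C * (T / n)) ≤ (n : ℝ) ^ (C * |τ n / (n * Real.logb 2 n)|) := by
    calc (2 : ℝ) ^ (C * (T / n)) ≤ 2 ^ (Real.logb 2 n * (C * |τ n / (n * Real.logb 2 n)|)) :=
          Real.rpow_le_rpow_of_exponent_le one_le_two hexp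
      _ = (n : ℝ) ^ (C * |τ n / (n * Real.logb 2 n)|) := by
          rw [Real.rpow_mul two_pos.le, Real.rpow_logb two_pos (by norm_num) hn₀]
  rw [Real.rpow_sub hn₀, Real.rpow_two]
  have : (n : ℝ) ^ 2 ≤ n ^ 2 * Real.logb 2 n := le_mul_of_one_le_right (by positivity) hlog
  gcongr

theorem logb_two_seven_ge : (160 / 57 : ℝ) ≤ Real.logb 2 7 := by
  rw [Real.le_logb_iff_rpow_le one_lt_two (by norm_num)]
  refine le_of_pow_le_pow_left₀ (n := 57) (by norm_num) (by norm_num) ?_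
  rw [← Real.rpow_natCast, ← Real.rpow_mul two_pos.le,
    show (160 / 57 : ℝ) * (57 : ℕ) = (160 : ℕ) by norm_num, Real.rpow_natCast]
  norm_num

theorem binEntropy_eighth_div_log_two :
    Real.binEntropy (1 / 8) / Real.log 2 = 3 - 7 / 8 * Real.logb 2 7 := by
  have hlog₈ : Real.log 8 = 3 * Real.log 2 := by
    rw [show (8 : ℝ) = 2 ^ 3 by norm_num, Real.log_pow]; norm_num
  have : Real.log 2 ≠ 0 := (Real.log_pos one_lt_two).ne'
  rw [Real.binEntropy, show (1 - 1 / 8 : ℝ)⁻¹ = 8 / 7 by norm_num, Real.log_div (by norm_num)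
    (by norm_num), one_div, inv_inv, hlog₈, Real.logb]
  field_simp
  ring

theorem two_lt_mul_one_sub_binEntropy_eighth :
    2 < 4.39 * (1 - Real.binEntropy (1 / 8) / Real.log 2) := by
  rw [binEntropy_eighth_div_log_two]
  linarith [logb_two_seven_ge]

end

theorem mainTheorem11_general {γ β : ℝ} (hγ₀ : 0 < γ) (hγ : γ ≤ 1 / 2)
    (hβ : 2 < β * (1 - Real.binEntropy γ / Real.log 2)) :
    ∃ C : ℝ, 0 < C ∧
      ∀ τ : ℕ → ℝ, τ =o[atTop] (fun n : ℕ => (n : ℝ) * Real.logb 2 n) →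
        ∃ ε : ℕ → ℝ, Tendsto ε atTop (𝓝 0) ∧
          ∀ᶠ n : ℕ in atTop, ∀ N : ℕ, (n : ℝ) ^ β ≤ N → ∀ T : ℕ,
            ∀ P : BranchingProgram (Fin N) n T, P.Computes (hammingCloseness γ n N) →
              n ^ 2 * Real.logb 2 n / 2 ^ (C * ((T : ℝ) / n)) ≤ P.cumulativeMemory ∧
              ((T : ℝ) ≤ τ n →
                (n : ℝ) ^ (2 - ε n) ≤ n ^ 2 * Real.logb 2 n / 2 ^ (C * ((T : ℝ) / n))) := by
  have hC : 0 < 384 / γ ^ 2 := by positivity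
  refine ⟨384 / γ ^ 2, hC, fun τ hτ => ?_⟩
  obtain ⟨ε, hε, hbound⟩ := exists_tendsto_zero_rpow_sub_le hC.le hτ
  refine ⟨ε, hε, ?_⟩
  filter_upwards [hbound, eventually_sq_mul_logb_div_le_cumulativeMemory hγ₀ hγ hβ]
    with n hε_le hCM N hN T P hP
  exact ⟨hCM N hN T P hP, hε_le T⟩

theorem mainTheorem11 :
    ∃ C : ℝ, 0 < C ∧
      ∀ τ : ℕ → ℝ, τ =o[atTop] (fun n : ℕ => (n : ℝ) * Real.logb 2 n) →
        ∃ ε : ℕ → ℝ, Tendsto ε atTop (𝓝 0) ∧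
          ∀ᶠ n : ℕ in atTop, ∀ N : ℕ, (n : ℝ) ^ (4.39 : ℝ) ≤ (N : ℝ) →
            ∀ T : ℕ, (T : ℝ) ≤ τ n →
              ∀ P : BranchingProgram (Fin N) n T, P.Computes (hammingCloseness (1 / 8) n N) →
                (n : ℝ) ^ 2 * Real.logb 2 n / (2 : ℝ) ^ (C * ((T : ℝ) / n))
                    ≤ P.cumulativeMemory ∧
                (n : ℝ) ^ (2 - ε n)
                    ≤ (n : ℝ) ^ 2 * Real.logb 2 n / (2 : ℝ) ^ (C * ((T : ℝ) / n)) := by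
  obtain ⟨C, hC, h⟩ := mainTheorem11_general (γ := 1 / 8) (by norm_num) (by norm_num)
    two_lt_mul_one_sub_binEntropy_eighth
  exact ⟨C, hC, fun τ hτ => (h τ hτ).imp fun ε ⟨hε, hn⟩ => ⟨hε, hn.mono
    fun n hn N hN T hT P hP => (hn N hN T P hP).imp_right fun hle => hle hT⟩⟩
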